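/- Let $p$ be a prime, let $\overline{\mathbf{Q}}_p$ be an algebraic closure of $\mathbf{Q}_p$, let $\mathbf{Q}_{p^2}=\mathbf{Q}_p(\mu_{p^2-1})\subset\overline{\mathbf{Q}}_p$ be the unramified quadratic extension of $\mathbf{Q}_p$, $\mathbf{Z}_{p^2}$ its ring of integers and $\sigma$ the nontrivial element of $\operatorname{Gal}(\mathbf{Q}_{p^2}/\mathbf{Q}_p)\simeq\mathbf{Z}/2\mathbf{Z}$. Assume that $d\in\mathbf{Z}_p$ has a square root $\sqrt d\in\mathbf{Z}_{p^2}$ with $\mathbf{Z}_{p^2}=\mathbf{Z}_p[\sqrt d]$. Consider the Lubin-Tate module over $\mathbf{Z}_{p^2}$ for the uniformizer $p$, with $[p](X)=pX+X^{p^2}$; for $a\in\mathbf{Z}_{p^2}$, let $[a](X)\in\mathbf{Z}_{p^2}[[X]]$ be the series with $[a](X)\equiv aX$ modulo degree $2$ and $[a]\circ[p]=[p]\circ[a]$. There is a unique character $\chi_2:\operatorname{Gal}(\overline{\mathbf{Q}}_p/\mathbf{Q}_{p^2})\to\mathbf{Z}_{p^2}^\times$ such that $g(x)=[\chi_2(g)](x)$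 for all $g$ and all torsion points $x$. Let $e=(e_n)_{n\geq 0}$ be a generator of the Tate module ($e_0=0$, $e_1\neq 0$, $[p](e_{n+1})=e_n$). There is a unique homomorphism $\pi:\operatorname{Gal}(\overline{\mathbf{Q}}_p/\mathbf{Q}_p)\to\mathbf{Z}_{p^2}^\times\rtimes\operatorname{Gal}(\mathbf{Q}_{p^2}/\mathbf{Q}_p)$ such that, if $\pi(g)=(a,\tau)$, then $\tau=g|_{\mathbf{Q}_{p^2}}$ and $g(e_n)=[a](e_n)$ for all $n$. Every $x\in\mathbf{Z}_{p^2}^\times$ can be written uniquely as $x=\omega(x)\langle x\rangle$ with $\omega(x)^{p^2-1}=1$ and $\langle x\rangle\in 1+p\mathbf{Z}_{p^2}$. For $r\in\mathbf{Z}/(p^2-1)\mathbf{Z}$ and $s\in\mathbf{Z}_p$, there is a unique character $\eta_{r,s}:\mathbf{Z}_{p^2}^\times\to\mathbf{Z}_{p^2}^\times$ such that $\eta_{r,s}(x)=\omega(x)^r\langle x\rangle^s$ for all $x$, where $\langle x\rangle^s=\sum_{k\geq 0}\binom{s}{k}(\langle x\rangle-1)^k$, and it commutes with $\sigma$. Let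 $\rho_{r,s}:\operatorname{Gal}(\overline{\mathbf{Q}}_p/\mathbf{Q}_p)\to\operatorname{GL}_2(\mathbf{Z}_p)$ be the composition of $\pi$, of $\eta_{r,s}\rtimes\operatorname{id}$, and of the homomorphism $\mathbf{Z}_{p^2}^\times\rtimes\operatorname{Gal}(\mathbf{Q}_{p^2}/\mathbf{Q}_p)\to\operatorname{GL}_2(\mathbf{Z}_p)$ given, for $x,y\in\mathbf{Z}_p$, by $$(x+y\sqrt d,1)\mapsto\begin{pmatrix}x&dy\\y&x\end{pmatrix},\qquad (x+y\sqrt d,\sigma)\mapsto\begin{pmatrix}x&-dy\\y&-x\end{pmatrix}.$$ Let $T_r(s)$ be the underlying $\mathbf{Z}_p$-module $\mathbf{Z}_p^2$ of $\rho_{r,s}$ and let $V_r(s)=\mathbf{Q}_p\otimes_{\mathbf{Z}_p}T_r(s)$. Put $\omega_2(g)=\omega(\chi_2(g))$ and $\langle g\rangle_2=\langle\chi_2(g)\rangle$ for $g\in\operatorname{Gal}(\overline{\mathbf{Q}}_p/\mathbf{Q}_{p^2})$. Then there is an isomorphism of representations of $\operatorname{Gal}(\overline{\mathbf{Q}}_p/\mathbf{Q}_p)$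 over $\mathbf{Q}_{p^2}$ $$\mathbf{Q}_{p^2}\otimes_{\mathbf{Q}_p}V_r(s)\simeq\operatorname{Ind}_{\mathbf{Q}_{p^2}}^{\mathbf{Q}_p}\bigl(\omega_2(\cdot)^r\langle\cdot\rangle_2^s\bigr).$$ -/

import Mathlib

open scoped TensorProduct Topology

noncomputable section

section Field

variable (p : ℕ) [Fact p.Prime]

/-- The unramified quadratic extension `Q_{p²}` of `Q_p` inside the fixed algebraic closure of
`Q_p`: the field generated by the roots of unity of order dividing `p ^ 2 - 1`. -/
def Qp2 : IntermediateField ℚ_[p] (PadicAlgCl p) :=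
  IntermediateField.adjoin ℚ_[p] {x : PadicAlgCl p | x ^ (p ^ 2 - 1) = 1}

/-- The ring of integers `Z_{p²}` of `Q_{p²}`. -/
abbrev Zp2 : Subalgebra ℤ_[p] (Qp2 p) := integralClosure ℤ_[p] (Qp2 p)

/-- The absolute Galois group of `Q_p`. -/
abbrev GQp : Type := PadicAlgCl p ≃ₐ[ℚ_[p]] PadicAlgCl p

/-- The absolute Galois group of `Q_{p²}`, as a subgroup of that of `Q_p`. -/
abbrev GQp2 : Subgroup (GQp p) := (Qp2 p).fixingSubgroup

/-- `Gal(Q_{p²}/Q_p)`, a group with two elements, the nontrivial one being the Frobenius. -/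
abbrev Gal2 : Type := Qp2 p ≃ₐ[ℚ_[p]] Qp2 p

/-- The inclusion of `Z_{p²}` in the algebraic closure of `Q_p`. -/
abbrev Zp2.toAlgCl (a : Zp2 p) : PadicAlgCl p := ((a : Qp2 p) : PadicAlgCl p)

/-- The natural action of `Gal(Q_{p²}/Q_p)` on the group `Z_{p²}ˣ`. -/
def galAct : Gal2 p →* MulAut (Zp2 p)ˣ where
  toFun τ := Units.mapEquiv ((τ.restrictScalars ℤ_[p]).mapIntegralClosure : Zp2 p ≃* Zp2 p)
  map_one' := by ext; rfl
  map_mul' _ _ := by ext; rfl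

/-- `Z_{p²}ˣ ⋊ Gal(Q_{p²}/Q_p)`, that is, `Z_{p²}ˣ ⋊ Z/2Z` where `ε` acts by `σ ^ ε`. -/
abbrev Dihedral : Type := (Zp2 p)ˣ ⋊[galAct p] Gal2 p

/-- `Z_{p²} = Z_p[√d]`, where `δ` is the chosen square root of `d ∈ Z_p`. -/
structure IsSqrtGenerator (d : ℤ_[p]) (δ : Zp2 p) : Prop where
  sq_eq : δ ^ 2 = algebraMap ℤ_[p] (Zp2 p) d
  adjoin_eq_top : Algebra.adjoin ℤ_[p] {δ} = ⊤

end Field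

section Sqrt

variable {p : ℕ} [Fact p.Prime]

theorem galAct_coe (τ : Gal2 p) (z : (Zp2 p)ˣ) :
    (((galAct p τ z : (Zp2 p)ˣ) : Zp2 p) : Qp2 p) = τ ((z : Zp2 p) : Qp2 p) := rfl

/-- The field `Q_p` contains fewer than `p ^ 2 - 1` roots of unity of order dividing
`p ^ 2 - 1`. -/
theorem exists_root_of_unity_notMem :
    ∃ x : PadicAlgCl p, x ^ (p ^ 2 - 1) = 1 ∧ ∀ c : ℤ_[p], algebraMap ℤ_[p] _ c ≠ x := by
  have hp : p.Prime := Fact.out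
  have h2 := hp.two_le
  have hn : p < p ^ 2 - 1 := by
    have : 2 * p ≤ p ^ 2 := by nlinarith
    omega
  by_contra! H
  have inj0 : Function.Injective (algebraMap ℤ_[p] (PadicAlgCl p)) := by
    rw [IsScalarTower.algebraMap_eq ℤ_[p] ℚ_[p] (PadicAlgCl p)]
    exact (algebraMap ℚ_[p] (PadicAlgCl p)).injective.comp Subtype.val_injective
  have : NeZero (p ^ 2 - 1) := ⟨by omega⟩
  obtain ⟨ζ, hζ⟩ := HasEnoughRootsOfUnity.exists_primitiveRoot (PadicAlgCl p) (p ^ 2 - 1)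
  have hζ1 : ζ ^ (p ^ 2 - 1) = 1 := hζ.pow_eq_one
  obtain ⟨c, hc⟩ := H ζ hζ1
  have hcp : IsPrimitiveRoot c (p ^ 2 - 1) :=
    IsPrimitiveRoot.of_map_of_injective (f := algebraMap ℤ_[p] (PadicAlgCl p)) (by rwa [hc]) inj0
  have key : IsPrimitiveRoot (PadicInt.toZMod c) (p ^ 2 - 1) := by
    refine IsPrimitiveRoot.iff (by omega) |>.mpr ⟨by rw [← map_pow, hcp.pow_eq_one, map_one], ?_⟩
    intro l hl0 hl h
    set u := c ^ l with hu
    have hun : u ^ (p ^ 2 - 1) = 1 := by rw [hu, ← pow_mul, mul_comm, pow_mul, hcp.pow_eq_one,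
      one_pow]
    have hu1 : u ≠ 1 := fun h1 => hcp.pow_ne_one_of_pos_of_lt hl0.ne' hl h1
    have hg : (∑ i ∈ Finset.range (p ^ 2 - 1), u ^ i) * (u - 1) = 0 := by
      rw [geom_sum_mul, hun, sub_self]
    rcases mul_eq_zero.mp hg with h0 | h0
    · have := congrArg PadicInt.toZMod h0
      rw [map_sum, map_zero] at this
      have e1 : PadicInt.toZMod u = 1 := by rw [hu, map_pow]; exact h
      simp only [map_pow, e1, one_pow, Finset.sum_const, Finset.card_range, nsmul_eq_mul,
        mul_one] at this
      rw [Nat.cast_sub (Nat.one_le_pow _ _ (by omega))] at this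
      simp at this
    · exact hu1 (sub_eq_zero.mp h0)
  have hord := key.eq_orderOf
  have hle : orderOf (PadicInt.toZMod c) ≤ Fintype.card (ZMod p) := orderOf_le_card_univ
  rw [ZMod.card] at hle
  omega

variable {d : ℤ_[p]} {δ : Zp2 p}

theorem IsSqrtGenerator.exists_coord (h : IsSqrtGenerator p d δ) (z : Zp2 p) :
    ∃ x y : ℤ_[p], z = algebraMap _ _ x + algebraMap _ _ y * δ := by
  have hz : z ∈ Algebra.adjoin ℤ_[p] {δ} := by rw [h.adjoin_eq_top]; trivial
  induction hz using Algebra.adjoin_induction with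
  | mem w hw => rw [Set.mem_singleton_iff] at hw; exact ⟨0, 1, by simp [hw]⟩
  | algebraMap r => exact ⟨r, 0, by simp⟩
  | add a b _ _ ha hb =>
    obtain ⟨x, y, rfl⟩ := ha
    obtain ⟨x', y', rfl⟩ := hb
    exact ⟨x + x', y + y', by simp only [map_add]; ring⟩
  | mul a b _ _ ha hb =>
    obtain ⟨x, y, rfl⟩ := ha
    obtain ⟨x', y', rfl⟩ := hb
    refine ⟨x * x' + d * y * y', x * y' + y * x', ?_⟩
    simp only [map_add, map_mul]
    linear_combination (algebraMap ℤ_[p] (Zp2 p) y) * (algebraMap ℤ_[p] (Zp2 p) y') * h.sq_eq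

theorem algebraMap_Zp2_injective : Function.Injective (algebraMap ℤ_[p] (Zp2 p)) := by
  intro a b hab
  have h1 : algebraMap ℚ_[p] (PadicAlgCl p) a = algebraMap ℚ_[p] (PadicAlgCl p) b :=
    congrArg (fun w : Zp2 p => ((w : Qp2 p) : PadicAlgCl p)) hab
  exact Subtype.val_injective ((algebraMap ℚ_[p] (PadicAlgCl p)).injective h1)

theorem IsSqrtGenerator.coord_zero (h : IsSqrtGenerator p d δ) {x y : ℤ_[p]}
    (hxy : algebraMap _ _ x + algebraMap _ _ y * δ = 0) : x = 0 ∧ y = 0 := by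
  by_cases hy : y = 0
  · subst hy
    refine ⟨algebraMap_Zp2_injective ?_, rfl⟩
    rw [map_zero, zero_mul, add_zero] at hxy
    rw [hxy, map_zero]
  exfalso
  obtain ⟨ζ, hζ, hne⟩ := exists_root_of_unity_notMem (p := p)
  have hp : p.Prime := Fact.out
  have hpos : 0 < p ^ 2 - 1 := by
    have := hp.two_le
    have : 2 * p ≤ p ^ 2 := by nlinarith
    omega
  let ζ' : Qp2 p := ⟨ζ, IntermediateField.subset_adjoin _ _ hζ⟩
  have hζ' : ζ' ^ (p ^ 2 - 1) = 1 := Subtype.ext hζ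
  have hint : IsIntegral ℤ_[p] ζ' := by
    refine IsIntegral.of_pow hpos ?_
    rw [hζ']; exact isIntegral_one
  obtain ⟨a, b, hab⟩ := h.exists_coord ⟨ζ', hint⟩
  -- `y ζ = y a - x b` lies in `Z_p`, so `ζ` lies in `Q_p` and is integral.
  have h1 : algebraMap ℤ_[p] (Zp2 p) y * ⟨ζ', hint⟩ = algebraMap ℤ_[p] (Zp2 p) (y * a - x * b) := by
    rw [hab]
    simp only [map_sub, map_mul]
    linear_combination (algebraMap ℤ_[p] (Zp2 p) b) * hxy
  have h2 : algebraMap ℚ_[p] (PadicAlgCl p) (y : ℚ_[p]) * ζ =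
      algebraMap ℚ_[p] (PadicAlgCl p) ((y * a - x * b : ℤ_[p]) : ℚ_[p]) :=
    congrArg (fun w : Zp2 p => ((w : Qp2 p) : PadicAlgCl p)) h1
  have hyq : (y : ℚ_[p]) ≠ 0 := by simpa using hy
  set c : ℚ_[p] := ((y * a - x * b : ℤ_[p]) : ℚ_[p]) / (y : ℚ_[p]) with hc
  have hcζ : algebraMap ℚ_[p] (PadicAlgCl p) c = ζ := by
    rw [hc, map_div₀, ← h2, mul_div_cancel_left₀]
    simpa using hyq
  have hcn : c ^ (p ^ 2 - 1) = 1 := by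
    apply (algebraMap ℚ_[p] (PadicAlgCl p)).injective
    rw [map_pow, hcζ, hζ, map_one]
  have hnorm : ‖c‖ ≤ 1 := by
    have := congrArg norm hcn
    rw [norm_pow, norm_one] at this
    exact ((pow_eq_one_iff_of_nonneg (norm_nonneg c) hpos.ne').mp this).le
  exact hne (⟨c, hnorm⟩ : ℤ_[p]) hcζ

/-- The basis `1, √d` of `Z_{p²}` over `Z_p`. -/
def IsSqrtGenerator.basis (h : IsSqrtGenerator p d δ) : Module.Basis (Fin 2) ℤ_[p] (Zp2 p) :=
  Module.Basis.mk (v := ![1, δ])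
    (by
      rw [LinearIndependent.pair_iff]
      intro s t hst
      refine h.coord_zero ?_
      simpa [Algebra.smul_def] using hst)
    (by
      intro z _
      obtain ⟨x, y, rfl⟩ := h.exists_coord z
      rw [← Algebra.smul_def, Algebra.algebraMap_eq_smul_one]
      refine add_mem (Submodule.smul_mem _ _ (Submodule.subset_span ⟨0, rfl⟩))
        (Submodule.smul_mem _ _ (Submodule.subset_span ⟨1, rfl⟩)))

theorem IsSqrtGenerator.eq_coord (h : IsSqrtGenerator p d δ) (z : Zp2 p) :
    z = algebraMap _ _ (h.basis.repr z 0) + algebraMap _ _ (h.basis.repr z 1) * δ := by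
  conv_lhs => rw [← h.basis.sum_repr z]
  simp [Fin.sum_univ_two, IsSqrtGenerator.basis, Algebra.smul_def]

theorem IsSqrtGenerator.repr_eq (h : IsSqrtGenerator p d δ) (x y : ℤ_[p]) :
    h.basis.repr (algebraMap _ _ x + algebraMap _ _ y * δ) 0 = x ∧
      h.basis.repr (algebraMap _ _ x + algebraMap _ _ y * δ) 1 = y := by
  set z := algebraMap ℤ_[p] (Zp2 p) x + algebraMap _ _ y * δ with hz
  have := h.eq_coord z
  have h0 := h.coord_zero (x := h.basis.repr z 0 - x) (y := h.basis.repr z 1 - y) (by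
    simp only [map_sub]
    linear_combination hz - this)
  exact ⟨sub_eq_zero.mp h0.1, sub_eq_zero.mp h0.2⟩

open scoped Classical in
/-- The sign character of `Gal(Q_{p²}/Q_p)`: it is `1` at the identity and `-1` elsewhere. -/
def galSign (τ : Gal2 p) : ℤ_[p] := if τ = 1 then 1 else -1

theorem IsSqrtGenerator.gal_apply (h : IsSqrtGenerator p d δ) (τ : Gal2 p) :
    τ (δ : Qp2 p) = ((algebraMap ℤ_[p] (Zp2 p) (galSign τ) * δ : Zp2 p) : Qp2 p) := by
  have hsq : (δ : Qp2 p) ^ 2 = algebraMap ℤ_[p] (Qp2 p) d := congrArg Subtype.val h.sq_eq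
  have hfix (c : ℤ_[p]) : τ (algebraMap ℤ_[p] (Qp2 p) c) = algebraMap ℤ_[p] (Qp2 p) c :=
    (τ.restrictScalars ℤ_[p]).commutes c
  unfold galSign
  split_ifs with hτ
  · simp [hτ]
  have h2 : (τ (δ : Qp2 p)) ^ 2 = (δ : Qp2 p) ^ 2 := by rw [← map_pow, hsq, hfix]
  rcases sq_eq_sq_iff_eq_or_eq_neg.mp h2 with h3 | h3
  · exfalso
    have hall (z : Zp2 p) : τ (z : Qp2 p) = z := by
      obtain ⟨x, y, rfl⟩ := h.exists_coord z
      calc τ _ = τ (algebraMap ℤ_[p] (Qp2 p) x) + τ (algebraMap ℤ_[p] (Qp2 p) y) * τ δ := by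
            rw [← map_mul, ← map_add]; rfl
        _ = _ := by rw [hfix, hfix, h3]; rfl
    have hpos : p ^ 2 - 1 ≠ 0 := by
      have := (Fact.out : p.Prime).two_le
      have : 2 * p ≤ p ^ 2 := by nlinarith
      omega
    have hid : (τ : Qp2 p →ₐ[ℚ_[p]] Qp2 p) = AlgHom.id ℚ_[p] (Qp2 p) := by
      refine IntermediateField.algHom_ext_of_eq_adjoin (S := Qp2 p) ℚ_[p] rfl ?_
      intro x hx
      set ζ : Qp2 p := ⟨x, IntermediateField.subset_adjoin _ _ hx⟩ with hζ
      have hζ1 : ζ ^ (p ^ 2 - 1) = 1 := Subtype.ext hx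
      have hint : IsIntegral ℤ_[p] ζ := by
        refine IsIntegral.of_pow (Nat.pos_of_ne_zero hpos) ?_
        rw [hζ1]; exact isIntegral_one
      exact hall ⟨ζ, hint⟩
    exact hτ (AlgEquiv.ext fun z => DFunLike.congr_fun hid z)
  · simp [h3]

theorem IsSqrtGenerator.galSign_mul (h : IsSqrtGenerator p d δ) (τ κ : Gal2 p) :
    galSign (τ * κ) = galSign τ * galSign κ := by
  have h1 := h.gal_apply (τ * κ)
  rw [AlgEquiv.mul_apply, h.gal_apply κ] at h1
  have hfix (c : ℤ_[p]) : τ (algebraMap ℤ_[p] (Qp2 p) c) = algebraMap ℤ_[p] (Qp2 p) c :=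
    (τ.restrictScalars ℤ_[p]).commutes c
  have h2 : τ ((algebraMap ℤ_[p] (Zp2 p) (galSign κ) * δ : Zp2 p) : Qp2 p)
      = ((algebraMap ℤ_[p] (Zp2 p) (galSign κ) *
        (algebraMap ℤ_[p] (Zp2 p) (galSign τ) * δ) : Zp2 p) : Qp2 p) := by
    rw [MulMemClass.coe_mul, map_mul, h.gal_apply τ]
    congr 1
    exact hfix _
  rw [h2] at h1
  have h3 := h.coord_zero (x := 0) (y := galSign κ * galSign τ - galSign (τ * κ)) (by
    have := Subtype.val_injective h1
    simp only [map_sub, map_mul, map_zero]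
    linear_combination this)
  linear_combination -h3.2

/-- The homomorphism `Z_{p²}ˣ ⋊ Z/2Z → GL₂(Z_p)` attached to `√d`, as matrices: with
`z = x + y √d`, it maps `(z, 1)` to `(x, d y; y, x)` and `(z, σ)` to `(x, -d y; y, -x)`. -/
def IsSqrtGenerator.toMatrix (h : IsSqrtGenerator p d δ) :
    Dihedral p →* Matrix (Fin 2) (Fin 2) ℤ_[p] where
  toFun a :=
    let x := h.basis.repr (a.left : Zp2 p) 0
    let y := h.basis.repr (a.left : Zp2 p) 1
    !![x, galSign a.right * (d * y); y, galSign a.right * x]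
  map_one' := by
    have h1 : ((1 : Dihedral p).left : Zp2 p) =
        algebraMap ℤ_[p] _ 1 + algebraMap ℤ_[p] _ 0 * δ := by simp
    have hr := h.repr_eq 1 0
    rw [← h1] at hr
    ext i j
    simp only [SemidirectProduct.one_right]
    rw [hr.1, hr.2]
    fin_cases i <;> fin_cases j <;> simp [galSign]
  map_mul' a b := by
    have hm : ((a * b).left : Zp2 p) = (a.left : Zp2 p) *
        (algebraMap _ _ (h.basis.repr (b.left : Zp2 p) 0) +
          algebraMap _ _ (h.basis.repr (b.left : Zp2 p) 1 * galSign a.right) * δ) := by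
      rw [SemidirectProduct.mul_left, Units.val_mul]
      congr 1
      have hfix (c : ℤ_[p]) :
          a.right (algebraMap ℤ_[p] (Qp2 p) c) = algebraMap ℤ_[p] (Qp2 p) c :=
        (a.right.restrictScalars ℤ_[p]).commutes c
      apply Subtype.val_injective
      rw [galAct_coe]
      conv_lhs => rw [h.eq_coord (b.left : Zp2 p)]
      calc a.right _ = a.right (algebraMap ℤ_[p] (Qp2 p) (h.basis.repr (b.left : Zp2 p) 0)) +
            a.right (algebraMap ℤ_[p] (Qp2 p) (h.basis.repr (b.left : Zp2 p) 1)) *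
              a.right δ := by rw [← map_mul, ← map_add]; rfl
        _ = _ := by
          rw [hfix, hfix, h.gal_apply, map_mul, mul_assoc]; rfl
    have ha := h.eq_coord (a.left : Zp2 p)
    generalize hx : h.basis.repr (a.left : Zp2 p) 0 = x at *
    generalize hy : h.basis.repr (a.left : Zp2 p) 1 = y at *
    generalize hx' : h.basis.repr (b.left : Zp2 p) 0 = x' at *
    generalize hy' : h.basis.repr (b.left : Zp2 p) 1 = y' at *
    have hm2 : ((a * b).left : Zp2 p) =
        algebraMap _ _ (x * x' + d * y * (y' * galSign a.right)) +
          algebraMap _ _ (x * (y' * galSign a.right) + y * x') * δ := by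
      rw [hm, ha]
      simp only [map_add, map_mul]
      linear_combination (algebraMap ℤ_[p] (Zp2 p) y) * (algebraMap ℤ_[p] (Zp2 p) y') *
        (algebraMap ℤ_[p] (Zp2 p) (galSign a.right)) * h.sq_eq
    have hr := h.repr_eq (x * x' + d * y * (y' * galSign a.right))
      (x * (y' * galSign a.right) + y * x')
    rw [← hm2] at hr
    have hs : galSign a.right * galSign a.right = 1 := by unfold galSign; split_ifs <;> simp
    rw [hr.1, hr.2, SemidirectProduct.mul_right, h.galSign_mul]
    ext i j
    fin_cases i <;> fin_cases j <;> simp [Matrix.mul_apply, Fin.sum_univ_two]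
    · ring
    · linear_combination (galSign b.right * d * x * y') * hs
    · ring
    · linear_combination (galSign b.right * d * y * y') * hs

/-- The homomorphism `Z_{p²}ˣ ⋊ Z/2Z → GL₂(Z_p)` attached to `√d`. -/
def IsSqrtGenerator.toGL (h : IsSqrtGenerator p d δ) : Dihedral p →* GL (Fin 2) ℤ_[p] :=
  h.toMatrix.toHomUnits

end Sqrt

section LubinTate

variable (p : ℕ) [Fact p.Prime]

/-- The Lubin-Tate series `[p](X) = p X + X ^ (p ^ 2)` for the uniformizer `p` of `Q_{p²}`. -/
def lubinTateSeries : PowerSeries (Zp2 p) :=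
  PowerSeries.C (p : Zp2 p) * PowerSeries.X + PowerSeries.X ^ (p ^ 2)

variable {p}

/-- `φ = [a](X)`: the power series `φ ≡ a X` modulo degree `2` which commutes with the Lubin-Tate
series under composition, that is, multiplication by `a` on the Lubin-Tate module. -/
structure IsLubinTateMul (a : Zp2 p) (φ : PowerSeries (Zp2 p)) : Prop where
  coeff_zero : PowerSeries.coeff 0 φ = 0
  coeff_one : PowerSeries.coeff 1 φ = a
  comm : PowerSeries.subst (lubinTateSeries p) φ = PowerSeries.subst φ (lubinTateSeries p)

/-- `y = [a](x)` for points `x`, `y` of the Lubin-Tate module. -/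
def LubinTateMulEq (a : Zp2 p) (x y : PadicAlgCl p) : Prop :=
  ∃ φ : PowerSeries (Zp2 p), IsLubinTateMul a φ ∧
    HasSum (fun k : ℕ => Zp2.toAlgCl p (PowerSeries.coeff k φ) * x ^ k) y

/-- `x` is a torsion point of the Lubin-Tate module: `[p ^ n](x) = 0` for some `n`. -/
def IsLubinTateTorsion (x : PadicAlgCl p) : Prop :=
  ∃ n : ℕ, (fun t : PadicAlgCl p => (p : PadicAlgCl p) * t + t ^ (p ^ 2))^[n] x = 0

/-- `e = (e₀, e₁, …)` is a generator of the Tate module of the Lubin-Tate module, that is,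
`[p](e_{n+1}) = e_n`, `e₀ = 0` and `e₁ ≠ 0`. -/
structure IsTateGenerator (e : ℕ → PadicAlgCl p) : Prop where
  zero : e 0 = 0
  one_ne_zero : e 1 ≠ 0
  step : ∀ n, (p : PadicAlgCl p) * e (n + 1) + e (n + 1) ^ (p ^ 2) = e n

/-- `χ` is the Lubin-Tate character `χ₂` of the Galois group of `Q_{p²}`: it gives the Galois
action on all torsion points of the Lubin-Tate module. -/
def IsLubinTateCharacter (χ : GQp2 p →* (Zp2 p)ˣ) : Prop :=
  ∀ (g : GQp2 p) (x : PadicAlgCl p), IsLubinTateTorsion x →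
    LubinTateMulEq (χ g : Zp2 p) x ((g : GQp p) x)

/-- `π` is the natural map from the Galois group of `Q_p` to
`Gal(Q_{p²}^LT / Q_p) ≃ Z_{p²}ˣ ⋊ Gal(Q_{p²}/Q_p)`: if `π g = (a, τ)` then `τ` is the
restriction of `g` to `Q_{p²}`, and `g` acts on the generator `e` of the Tate module as `[a]`. -/
structure IsLubinTateProjection (e : ℕ → PadicAlgCl p) (π : GQp p →* Dihedral p) : Prop where
  right : ∀ (g : GQp p) (z : Qp2 p), (((π g).right z : Qp2 p) : PadicAlgCl p) = g z
  left : ∀ (g : GQp p) (n : ℕ), LubinTateMulEq ((π g).left : Zp2 p) (e n) (g (e n))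

end LubinTate

section Eta

variable {p : ℕ} [Fact p.Prime]

/-- `x = w y` with `w = ω(x)` and `y = ⟨x⟩`. -/
def IsOmegaDiam (x w y : (Zp2 p)ˣ) : Prop :=
  x = w * y ∧ w ^ (p ^ 2 - 1) = 1 ∧ (p : Zp2 p) ∣ (y : Zp2 p) - 1

/-- `η` is the character `η_{r,s} : x ↦ ω(x) ^ r ⟨x⟩ ^ s`, where
`⟨x⟩ ^ s = ∑ k, (s choose k) (⟨x⟩ - 1) ^ k`, a sum in the `p`-adic topology. -/
def IsEta (r : ZMod (p ^ 2 - 1)) (s : ℤ_[p]) (η : (Zp2 p)ˣ →* (Zp2 p)ˣ) : Prop :=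
  ∀ x w y : (Zp2 p)ˣ, IsOmegaDiam x w y →
    ∃ t : (Zp2 p)ˣ, η x = w ^ r.val * t ∧
      HasSum (fun k : ℕ => algebraMap ℤ_[p] (Zp2 p) (Ring.choose s k) * ((y : Zp2 p) - 1) ^ k)
        (t : Zp2 p)

end Eta

section Rep

/-- Extension of scalars of a representation. -/
def Representation.extendScalars {k G V : Type*} [CommSemiring k] [Monoid G] [AddCommMonoid V]
    [Module k V] (A : Type*) [CommSemiring A] [Algebra k A] (ρ : Representation k G V) :
    Representation A G (A ⊗[k] V) where
  toFun g := (ρ g).baseChange A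
  map_one' := by rw [map_one]; exact LinearMap.baseChange_id
  map_mul' g h := by rw [map_mul]; exact LinearMap.baseChange_mul _ _

/-- The representation on column vectors attached to a homomorphism to `GL_n`. -/
def glRep {k G : Type*} [CommRing k] [Group G] {n : ℕ} (ρ : G →* GL (Fin n) k) :
    Representation k G (Fin n → k) where
  toFun g := Matrix.mulVecLin (ρ g : Matrix (Fin n) (Fin n) k)
  map_one' := by simp [Module.End.one_eq_id]
  map_mul' g h := by simp [Matrix.mulVecLin_mul, Module.End.mul_eq_comp]

variable {p : ℕ} [Fact p.Prime]

/-- The one-dimensional representation over `Q_{p²}` attached to a character with values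
in `Z_{p²}ˣ`. -/
def charRep {G : Type*} [Group G] (ψ : G →* (Zp2 p)ˣ) : Representation (Qp2 p) G (Qp2 p) where
  toFun g := ((ψ g : Zp2 p) : Qp2 p) • LinearMap.id
  map_one' := by ext; simp
  map_mul' g h := by ext; simp [mul_comm]

variable {d : ℤ_[p]} {δ : Zp2 p} {η : (Zp2 p)ˣ →* (Zp2 p)ˣ}

/-- `η ⋊ id`, for `η` commuting with the action of `Gal(Q_{p²}/Q_p)`. -/
def etaMap (hη : ∀ τ z, η (galAct p τ z) = galAct p τ (η z)) : Dihedral p →* Dihedral p :=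
  SemidirectProduct.map η (MonoidHom.id _) fun τ => MonoidHom.ext fun z => hη τ z

/-- `ρ_{r,s} : Gal → GL₂(Z_p)`, the composition of the projection `π` to `Z_{p²}ˣ ⋊ Z/2Z`, of
`η ⋊ id` and of the homomorphism to `GL₂(Z_p)` attached to `√d`. -/
def rhoRS (h : IsSqrtGenerator p d δ) (hη : ∀ τ z, η (galAct p τ z) = galAct p τ (η z))
    (π : GQp p →* Dihedral p) : GQp p →* GL (Fin 2) ℤ_[p] :=
  h.toGL.comp ((etaMap hη).comp π)

/-- `V_r(s) = Q_p ⊗ T_r(s)`, where `T_r(s)` is the `Z_p`-module underlying `ρ_{r,s}`. -/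
def VRS (h : IsSqrtGenerator p d δ) (hη : ∀ τ z, η (galAct p τ z) = galAct p τ (η z))
    (π : GQp p →* Dihedral p) :
    Representation ℚ_[p] (GQp p) (ℚ_[p] ⊗[ℤ_[p]] (Fin 2 → ℤ_[p])) :=
  (glRep (rhoRS h hη π)).extendScalars ℚ_[p]

/-- The induced representation from the Galois group of `Q_{p²}` to that of `Q_p`. -/
abbrev indRep (ψ : GQp2 p →* (Zp2 p)ˣ) := Representation.ind (GQp2 p).subtype (charRep ψ)

end Rep

end

/-! Over `Q_{p²}` the matrix of multiplication by z = x + y√d has the eigenvectors v± = √d ⊗ e₁ ±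
e₂, with eigenvalues z and its conjugate, and the matrices attached to σ interchange the two lines.
If g fixes `Q_{p²}`, then π(g) = (χ₂(g), 1), so g multiplies v₊ by η(χ₂(g)). If g₀ does not fix it,
then g₀⁻¹v₊ is a nonzero multiple of v₋. A representation with basis v, g₀⁻¹v, where v is an
eigenvector of a subgroup of index two, is induced from that subgroup (`nonempty_equiv_ind`). This
proves the isomorphism (`nonempty_equiv_indRep`).

Most of the work goes into the existence and uniqueness of χ₂, π and η. The Lubin-Tate lemma
(`exists_series`, `series_unique`) solves the commutation equation degree by degree and yields the
series [a] and a formal group law. The group law enters only through `exists_one_add`, whose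
consequence `act_eq_act_iff` says when two multiplications agree at a point.

The key fact is that two generators of the Tate module differ by exactly one unit
(`IsTate.exists_unit`, `IsTate.unique`). Existence holds by counting: the q = p² lifts of a unit to
the next level give q distinct roots of a polynomial of degree q. Applied to e and its image under
g, this defines π(g); transporting [a] by g twists a by σ, whence the semidirect product. The
character χ₂ is the restriction of π. Series are evaluated in `ℂ_[p]`, which is complete, unlike the
algebraic closure.

The character η comes from the Teichmüller decomposition and the binomial series, which is
continuous in s and equals the usual power at natural numbers; density then makes it multiplicative
(`binPow_mul`). -/

/-! ### The Lubin-Tate lemma for p X + X ^ q in several variables. -/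

section LubinTateSeries

open MvPowerSeries

variable {R : Type*} [CommRing R] {σ : Type*} {p q : ℕ}

/-- The family of series `p X_i + X_i ^ q`. -/
noncomputable def ltFamily (R : Type*) [CommRing R] {σ : Type*} (p q : ℕ) (i : σ) :
    MvPowerSeries σ R :=
  C (p : R) * X i + X i ^ q

/-- The conditions on `R`, `p` and `q` under which the Lubin-Tate lemma holds for the series
`p X + X ^ q`. -/
structure IsLubinTateBase (R : Type*) [CommRing R] (p m : ℕ) : Prop where
  prime : p.Prime
  pos : m ≠ 0
  cancel : ∀ x y : R, (p : R) * x = p * y → x = y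
  isUnit : ∀ n : ℕ, n ≠ 0 → IsUnit (1 - (p : R) ^ n)
  dvd : ∀ c : R, (p : R) ∣ c ^ p ^ m - c

theorem constantCoeff_ltFamily (hq : q ≠ 0) (i : σ) :
    constantCoeff (ltFamily R p q i) = 0 := by
  simp [ltFamily, hq]

theorem hasSubst_ltFamily [Finite σ] (hq : q ≠ 0) : HasSubst (ltFamily (σ := σ) R p q) :=
  hasSubst_of_constantCoeff_zero (constantCoeff_ltFamily hq)

/-- Since p X + X ^ q = X (p + X ^ (q - 1)), the monomial of exponent d is sent to itself times a
series with constant term p ^ |d|. In the lowest degree, substitution is therefore diagonal. -/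
theorem coeff_subst_ltFamily [Finite σ] (hq : 2 ≤ q) {n : ℕ} {h : MvPowerSeries σ R}
    (hh : ∀ d, d.degree < n → coeff d h = 0) {e : σ →₀ ℕ} (he : e.degree ≤ n) :
    coeff e (subst (ltFamily R p q) h) = (p : R) ^ n * coeff e h := by
  classical
  have key (d : σ →₀ ℕ) : ∃ G : MvPowerSeries σ R, constantCoeff G = (p : R) ^ d.degree ∧
      d.prod (fun i k => ltFamily R p q i ^ k) = monomial d 1 * G := by
    refine ⟨d.prod fun i k => (C (p : R) + X i ^ (q - 1)) ^ k, ?_, ?_⟩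
    · rw [Finsupp.prod, map_prod]
      simp only [map_pow, map_add, constantCoeff_C, constantCoeff_X]
      simp [zero_pow (show q - 1 ≠ 0 by omega), Finset.prod_pow_eq_pow_sum, Finsupp.degree]
      rfl
    · rw [monomial_one_eq, Finsupp.prod, Finsupp.prod, Finsupp.prod, ← Finset.prod_mul_distrib]
      refine Finset.prod_congr rfl fun i _ => ?_
      rw [← mul_pow, ltFamily]
      congr 1
      obtain ⟨k, rfl⟩ : ∃ k, q = k + 1 := ⟨q - 1, by omega⟩
      simp only [Nat.add_sub_cancel]
      ring
  rw [coeff_subst (hasSubst_ltFamily (by omega)), finsum_eq_single _ e]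
  · obtain ⟨G, hG, hp⟩ := key e
    rw [hp, coeff_monomial_mul, if_pos le_rfl, tsub_self, coeff_zero_eq_constantCoeff, hG,
      smul_eq_mul, one_mul, mul_comm]
    rcases he.lt_or_eq with h1 | h1
    · rw [hh e h1, mul_zero, mul_zero]
    · rw [h1]
  · intro d hd
    rcases lt_or_ge d.degree n with h1 | h1
    · rw [hh d h1, zero_smul]
    obtain ⟨G, hG, hp⟩ := key d
    rw [hp, coeff_monomial_mul, if_neg, smul_zero]
    intro hle
    refine hd (le_antisymm hle ?_)
    have h2 : (e - d).degree + d.degree = e.degree := by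
      rw [← map_add, tsub_add_cancel_of_le hle]
    have h3 : (e - d).degree = 0 := by omega
    rw [Finsupp.degree_eq_zero_iff, tsub_eq_zero_iff_le] at h3
    exact h3

/-- Modulo p the substitution is X ↦ X ^ q, and the q-power Frobenius is the identity on R / p, so
h(X ^ q) = h(X) ^ q there. -/
theorem natCast_dvd_subst_ltFamily_sub_pow [Finite σ] {m : ℕ} (hR : IsLubinTateBase R p m)
    (h : MvPowerSeries σ R) (e : σ →₀ ℕ) :
    (p : R) ∣ coeff e (subst (ltFamily R p (p ^ m)) h - h ^ p ^ m) := by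
  have hp0 := hR.prime.ne_zero
  -- When p is invertible the quotient is zero and has no characteristic p, but divisibility is then
  -- automatic.
  by_cases hnt : IsUnit (p : R)
  · exact hnt.dvd
  let Q := R ⧸ Ideal.span {(p : R)}
  let f : R →+* Q := Ideal.Quotient.mk _
  have : Nontrivial Q := Ideal.Quotient.nontrivial_iff.mpr (by rwa [Ne, Ideal.span_singleton_eq_top])
  have hpQ : (p : Q) = 0 := by
    rw [← map_natCast f]; exact Ideal.Quotient.eq_zero_iff_mem.mpr (Ideal.mem_span_singleton_self _)
  have : Fact p.Prime := ⟨hR.prime⟩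
  have : CharP Q p := by
    refine (CharP.charP_iff_prime_eq_zero hR.prime).mpr hpQ
  have hF : iterateFrobenius Q p m = RingHom.id Q := by
    refine RingHom.ext fun x => ?_
    obtain ⟨c, rfl⟩ : ∃ c, f c = x := Ideal.Quotient.mk_surjective x
    rw [iterateFrobenius_def, RingHom.id_apply, ← map_pow, Ideal.Quotient.eq,
      Ideal.mem_span_singleton]
    exact hR.dvd c
  have h1 : MvPowerSeries.map f (subst (ltFamily R p (p ^ m)) h - h ^ p ^ m) = 0 := by
    rw [map_sub, map_pow, map_subst (hasSubst_ltFamily (pow_ne_zero _ hp0)),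
      ← map_iterateFrobenius_expand p hp0 (MvPowerSeries.map f h) m, hF, MvPowerSeries.map_id,
      RingHom.id_apply, sub_eq_zero, expand, substAlgHom_apply]
    congr 1
    funext i
    have : f (p : R) = 0 := by rw [map_natCast, hpQ]
    simp only [ltFamily, map_add, map_mul, MvPowerSeries.map_C, this, map_zero, zero_mul, zero_add,
      map_pow, map_X]
  have h2 : f (coeff e (subst (ltFamily R p (p ^ m)) h - h ^ p ^ m)) = 0 := by
    rw [← coeff_map, h1, map_zero]
  exact Ideal.mem_span_singleton.mp (Ideal.Quotient.eq_zero_iff_mem.mp h2)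

theorem coeff_mul_eq_zero_of_degree {D G : MvPowerSeries σ R} {e : σ →₀ ℕ}
    (hD : ∀ d, d.degree < e.degree → coeff d D = 0) (hG : constantCoeff G = 0) :
    coeff e (D * G) = 0 := by
  classical
  rw [coeff_mul]
  refine Finset.sum_eq_zero fun x hx => ?_
  rw [Finset.HasAntidiagonal.mem_antidiagonal] at hx
  by_cases h : x.2 = 0
  · rw [h, coeff_zero_eq_constantCoeff, hG, mul_zero]
  · rw [hD, zero_mul]
    rw [← hx, map_add]
    have : x.2.degree ≠ 0 := by rwa [Ne, Finsupp.degree_eq_zero_iff]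
    omega

/-- `q`-th powers of series without constant term differ in higher degree than the series. -/
theorem coeff_pow_eq_of_degree {F G : MvPowerSeries σ R} {e : σ →₀ ℕ} (hq : 2 ≤ q)
    (hF : constantCoeff F = 0) (hG : constantCoeff G = 0)
    (h : ∀ d, d.degree < e.degree → coeff d F = coeff d G) :
    coeff e (F ^ q) = coeff e (G ^ q) := by
  -- The cofactor of F - G in F ^ q - G ^ q is homogeneous of degree q - 1 ≥ 1 in F and G, hence has
  -- no constant term.
  rw [← sub_eq_zero, ← map_sub, ← (Commute.all F G).mul_geom_sum₂ q]
  refine coeff_mul_eq_zero_of_degree (fun d hd => by rw [map_sub, h d hd, sub_self]) ?_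
  rw [map_sum]
  refine Finset.sum_eq_zero fun i hi => ?_
  rw [map_mul, map_pow, map_pow, hF, hG, ← pow_add, zero_pow]
  rw [Finset.mem_range] at hi
  omega

namespace IsLubinTateBase

variable {m : ℕ}

theorem two_le (hR : IsLubinTateBase R p m) : 2 ≤ p ^ m :=
  hR.prime.two_le.trans (Nat.le_self_pow hR.pos p)

variable [Finite σ]

/-- The defect of commutation with the Lubin-Tate series. -/
noncomputable def defect (p q : ℕ) (F : MvPowerSeries σ R) : MvPowerSeries σ R :=
  subst (ltFamily R p q) F - (C (p : R) * F + F ^ q)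

/-- A change of F in degree n contributes p ^ n through the substitution and -p through the linear
term; the q-th power is not affected in that degree. The factor p ^ n - p = -p (1 - p ^ (n - 1))
governs both existence and uniqueness. -/
theorem coeff_defect_sub (hq : 2 ≤ q) {F G : MvPowerSeries σ R} {e : σ →₀ ℕ}
    (hF : constantCoeff F = 0) (hG : constantCoeff G = 0)
    (h : ∀ d, d.degree < e.degree → coeff d F = coeff d G) :
    coeff e (defect p q F) - coeff e (defect p q G) =
      ((p : R) ^ e.degree - p) * (coeff e F - coeff e G) := by
  have h1 := coeff_subst_ltFamily (p := p) hq (n := e.degree) (h := F - G) (e := e)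
    (fun d hd => by rw [map_sub, h d hd, sub_self]) le_rfl
  rw [subst_sub (hasSubst_ltFamily (by omega)), map_sub, map_sub] at h1
  simp only [defect, map_sub, map_add, coeff_C_mul, coeff_pow_eq_of_degree hq hF hG h]
  linear_combination h1

theorem natCast_dvd_coeff_defect (hR : IsLubinTateBase R p m) (F : MvPowerSeries σ R)
    (e : σ →₀ ℕ) : (p : R) ∣ coeff e (defect p (p ^ m) F) := by
  have h1 := natCast_dvd_subst_ltFamily_sub_pow hR F e
  have h2 : coeff e (defect p (p ^ m) F) =
      coeff e (subst (ltFamily R p (p ^ m)) F - F ^ p ^ m) - p * coeff e F := by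
    simp only [defect, map_sub, map_add, coeff_C_mul]; ring
  rw [h2]
  exact dvd_sub h1 (dvd_mul_right _ _)

/-- The defect in degree n is p c, and the correction must solve (1 - p ^ (n - 1)) x = c. This is
possible because the factor is a unit for n ≥ 2. -/
theorem exists_step (hR : IsLubinTateBase R p m) {n : ℕ} (hn : 2 ≤ n) {F : MvPowerSeries σ R}
    (hF : constantCoeff F = 0)
    (h : ∀ d, d.degree < n → coeff d (defect p (p ^ m) F) = 0) :
    ∃ G : MvPowerSeries σ R, constantCoeff G = 0 ∧ (∀ d, d.degree < n → coeff d G = coeff d F) ∧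
      ∀ d, d.degree < n + 1 → coeff d (defect p (p ^ m) G) = 0 := by
  classical
  choose c hc using fun e => hR.natCast_dvd_coeff_defect F e
  obtain ⟨u, hu⟩ := hR.isUnit (n - 1) (by omega)
  let G : MvPowerSeries σ R :=
    fun e => if e.degree = n then coeff e F + (↑u⁻¹ : R) * c e else coeff e F
  have hGe (e : σ →₀ ℕ) :
      coeff e G = if e.degree = n then coeff e F + (↑u⁻¹ : R) * c e else coeff e F := rfl
  have hG : constantCoeff G = 0 := by
    rw [← coeff_zero_eq_constantCoeff_apply, hGe, if_neg, coeff_zero_eq_constantCoeff_apply, hF]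
    simp; omega
  have hlt (d : σ →₀ ℕ) (hd : d.degree < n) : coeff d G = coeff d F := by
    rw [hGe, if_neg hd.ne]
  refine ⟨G, hG, hlt, fun d hd => ?_⟩
  have h1 := coeff_defect_sub (p := p) hR.two_le (e := d) hG hF
    fun d' hd' => hlt d' (by omega)
  rcases Nat.lt_succ_iff_lt_or_eq.mp hd with h2 | h2
  · rw [h d h2, hlt d h2] at h1
    simpa using h1
  · rw [hGe, if_pos h2, h2, hc d] at h1
    have h3 : (p : R) ^ n = p * p ^ (n - 1) := by
      rw [← pow_succ']; congr 1; omega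
    have h4 : (u : R) * ↑u⁻¹ = 1 := u.mul_inv
    rw [hu] at h4
    rw [h3] at h1
    linear_combination h1 - (p : R) * c d * h4

theorem exists_series (hR : IsLubinTateBase R p m) {L : MvPowerSeries σ R}
    (hL : constantCoeff L = 0) :
    ∃ F : MvPowerSeries σ R, constantCoeff F = 0 ∧ (∀ d, d.degree < 2 → coeff d F = coeff d L) ∧
      subst (ltFamily R p (p ^ m)) F = C (p : R) * F + F ^ p ^ m := by
  let S (k : ℕ) : Type _ := {F : MvPowerSeries σ R // constantCoeff F = 0 ∧
    ∀ d, d.degree < k + 2 → coeff d (defect p (p ^ m) F) = 0}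
  have h0 : ∀ d, d.degree < 0 + 2 → coeff d (defect p (p ^ m) L) = 0 := by
    intro d hd
    have := coeff_defect_sub (p := p) hR.two_le (e := d) (G := 0) hL (map_zero _) fun d' hd' => by
      have h0 : d'.degree = 0 := by omega
      rw [Finsupp.degree_eq_zero_iff] at h0
      rw [h0, coeff_zero_eq_constantCoeff_apply, hL, map_zero]
    have hz : defect p (p ^ m) (0 : MvPowerSeries σ R) = 0 := by
      have h1 := hR.two_le
      rw [defect, ← substAlgHom_apply (hasSubst_ltFamily (by omega)), map_zero,
        zero_pow (by omega), mul_zero, add_zero, sub_zero]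
    rw [hz, map_zero, sub_zero, sub_zero] at this
    rw [this]
    by_cases hd0 : d = 0
    · rw [hd0, coeff_zero_eq_constantCoeff_apply, hL, mul_zero]
    · have : d.degree = 1 := by
        have : d.degree ≠ 0 := by rwa [Ne, Finsupp.degree_eq_zero_iff]
        omega
      rw [this, pow_one, sub_self, zero_mul]
  choose next hn0 hn1 hn2 using fun (k : ℕ) (F : S k) =>
    hR.exists_step (n := k + 2) (by omega) F.2.1 F.2.2
  let s : ∀ k, S k := fun k => Nat.rec ⟨L, hL, h0⟩ (fun k F => ⟨next k F, hn0 k F, hn2 k F⟩) k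
  have hs (k : ℕ) (d : σ →₀ ℕ) (hd : d.degree < k + 2) :
      coeff d (s (k + 1)).1 = coeff d (s k).1 := hn1 k (s k) d hd
  have hs' (j k : ℕ) (d : σ →₀ ℕ) (hd : d.degree < k + 2) :
      coeff d (s (k + j)).1 = coeff d (s k).1 := by
    induction j with
    | zero => rfl
    | succ j ih => rw [← add_assoc, hs _ _ (by omega), ih]
  -- Stage k is already final in all degrees below k + 2, so the coefficient in degree n may be read
  -- off at stage n.
  let F : MvPowerSeries σ R := fun e => coeff e (s e.degree).1
  have hF (k : ℕ) (d : σ →₀ ℕ) (hd : d.degree < k + 2) : coeff d F = coeff d (s k).1 := by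
    rcases le_total k d.degree with h | h
    · obtain ⟨j, hj⟩ := Nat.exists_eq_add_of_le h
      have : coeff d F = coeff d (s (k + j)).1 := by rw [← hj]; rfl
      rw [this, hs' _ _ _ hd]
    · obtain ⟨j, hj⟩ := Nat.exists_eq_add_of_le h
      have := hs' j d.degree d (by omega)
      rw [← hj] at this
      exact this.symm
  have hF0 : constantCoeff F = 0 := by
    rw [← coeff_zero_eq_constantCoeff_apply, hF 0 0 (by simp), coeff_zero_eq_constantCoeff_apply]
    exact (s 0).2.1
  refine ⟨F, hF0, fun d hd => hF 0 d hd, ?_⟩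
  rw [← sub_eq_zero]
  ext e
  have h1 := coeff_defect_sub (p := p) hR.two_le (e := e) hF0 (s e.degree).2.1
    fun d hd => hF e.degree d (by omega)
  rw [(s e.degree).2.2 e (by omega), hF e.degree e (by omega), sub_self, mul_zero, sub_zero] at h1
  exact h1

theorem series_unique (hR : IsLubinTateBase R p m) {F G : MvPowerSeries σ R}
    (hF0 : constantCoeff F = 0) (hG0 : constantCoeff G = 0)
    (h : ∀ d, d.degree < 2 → coeff d F = coeff d G)
    (hF : subst (ltFamily R p (p ^ m)) F = C (p : R) * F + F ^ p ^ m)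
    (hG : subst (ltFamily R p (p ^ m)) G = C (p : R) * G + G ^ p ^ m) : F = G := by
  have key (n : ℕ) : ∀ d, d.degree < n → coeff d F = coeff d G := by
    induction n with
    | zero => intro d hd; omega
    | succ n ih =>
      intro d hd
      rcases Nat.lt_succ_iff_lt_or_eq.mp hd with h1 | h1
      · exact ih d h1
      by_cases hn : n < 2
      · exact h d (by omega)
      have h2 := coeff_defect_sub (p := p) hR.two_le (e := d) hF0 hG0
        fun d' hd' => ih d' (by omega)
      rw [defect, defect, hF, hG, sub_self, sub_self, map_zero, sub_zero, h1] at h2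
      have h3 : (p : R) ^ n = p * p ^ (n - 1) := by
        rw [← pow_succ']; congr 1; omega
      have h4 : (1 - (p : R) ^ (n - 1)) * (coeff d F - coeff d G) = 0 :=
        hR.cancel _ _ (by rw [h3] at h2; linear_combination h2)
      rw [(hR.isUnit (n - 1) (by omega)).mul_right_eq_zero, sub_eq_zero] at h4
      exact h4
  ext d
  exact key (d.degree + 1) d (by omega)

end IsLubinTateBase

end LubinTateSeries

/-! ### The series [a](X) and their composition. -/

section LubinTateEndo

variable {R : Type*} [CommRing R] {p m : ℕ}

/-- A formal solution of `F (f X₁, f X₂, …) = f (F (X₁, X₂, …))` for `f = p X + X ^ q`. -/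
def CommutesLT {σ : Type*} (p q : ℕ) (F : MvPowerSeries σ R) : Prop :=
  MvPowerSeries.constantCoeff F = 0 ∧
    MvPowerSeries.subst (ltFamily R p q) F = MvPowerSeries.C (p : R) * F + F ^ q

theorem CommutesLT.subst {σ τ : Type*} [Finite σ] [Finite τ] {q : ℕ} (hq : q ≠ 0)
    {F : MvPowerSeries σ R} (hF : CommutesLT p q F) {a : σ → MvPowerSeries τ R}
    (ha : ∀ i, CommutesLT p q (a i)) : CommutesLT p q (MvPowerSeries.subst a F) := by
  have ha' : MvPowerSeries.HasSubst a :=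
    MvPowerSeries.hasSubst_of_constantCoeff_zero fun i => (ha i).1
  refine ⟨MvPowerSeries.constantCoeff_subst_eq_zero ha' (fun i => (ha i).1) hF.1, ?_⟩
  rw [MvPowerSeries.subst_comp_subst_apply ha' (hasSubst_ltFamily hq)]
  have h1 : (fun i => MvPowerSeries.subst (ltFamily R p q) (a i)) =
      fun i => MvPowerSeries.subst a (ltFamily R p q i) := by
    funext i
    rw [(ha i).2, ltFamily, ← MvPowerSeries.coe_substAlgHom ha', map_add, map_mul, map_pow,
      MvPowerSeries.substAlgHom_X]
    congr 2
    rw [MvPowerSeries.coe_substAlgHom ha', MvPowerSeries.subst_C]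
  rw [h1, ← MvPowerSeries.subst_comp_subst_apply (hasSubst_ltFamily hq) ha', hF.2,
    ← MvPowerSeries.coe_substAlgHom ha', map_add, map_mul, map_pow]
  congr 2
  rw [MvPowerSeries.coe_substAlgHom ha', MvPowerSeries.subst_C]

theorem CommutesLT.X {σ : Type*} [Finite σ] {q : ℕ} (hq : q ≠ 0) (i : σ) :
    CommutesLT p q (MvPowerSeries.X i : MvPowerSeries σ R) :=
  ⟨by simp, by rw [MvPowerSeries.subst_X (hasSubst_ltFamily hq)]; rfl⟩

theorem CommutesLT.zero {σ : Type*} [Finite σ] {q : ℕ} (hq : q ≠ 0) :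
    CommutesLT p q (0 : MvPowerSeries σ R) :=
  ⟨by simp, by rw [← MvPowerSeries.coe_substAlgHom (hasSubst_ltFamily hq), map_zero,
    zero_pow hq, mul_zero, zero_add]⟩

theorem MvPowerSeries.constantCoeff_subst_of_constantCoeff_zero {σ τ : Type*} [Finite σ]
    {a : σ → MvPowerSeries τ R} (ha : ∀ i, constantCoeff (a i) = 0) (G : MvPowerSeries σ R) :
    constantCoeff (subst a G) = constantCoeff G := by
  have ha' : HasSubst a := hasSubst_of_constantCoeff_zero ha
  have h1 : constantCoeff (subst a (G - C (constantCoeff G))) = 0 :=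
    constantCoeff_subst_eq_zero ha' ha (by simp)
  rw [subst_sub ha', map_sub, subst_C, constantCoeff_C, sub_eq_zero] at h1
  exact h1

open PowerSeries

/-- `φ = [a](X)` for the Lubin-Tate series `p X + X ^ q`. -/
structure IsLTEndo (p q : ℕ) (a : R) (φ : R⟦X⟧) : Prop where
  commutes : CommutesLT (σ := Unit) p q φ
  coeff_one : coeff 1 φ = a

namespace IsLTEndo

variable {q : ℕ} {a b c : R} {φ ψ : R⟦X⟧}

theorem constantCoeff (h : IsLTEndo p q a φ) : PowerSeries.constantCoeff φ = 0 := h.commutes.1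

theorem hasSubst (h : IsLTEndo p q a φ) : HasSubst φ :=
  HasSubst.of_constantCoeff_zero' h.constantCoeff

theorem coeff_one_X_mul (φ : R⟦X⟧) : coeff 1 (X * φ) = PowerSeries.constantCoeff φ := by
  rw [← coeff_zero_eq_constantCoeff_apply]
  exact coeff_succ_X_mul 0 φ

theorem unique (hR : IsLubinTateBase R p m) (hφ : IsLTEndo p (p ^ m) a φ)
    (hψ : IsLTEndo p (p ^ m) a ψ) : φ = ψ := by
  refine hR.series_unique (σ := Unit) hφ.commutes.1 hψ.commutes.1 (fun d hd => ?_)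
    hφ.commutes.2 hψ.commutes.2
  obtain ⟨n, rfl⟩ : ∃ n, d = Finsupp.single () n := ⟨d (), by ext; simp⟩
  rw [Finsupp.degree_single] at hd
  change coeff n φ = coeff n ψ
  interval_cases n
  · rw [coeff_zero_eq_constantCoeff_apply, coeff_zero_eq_constantCoeff_apply, hφ.constantCoeff,
      hψ.constantCoeff]
  · rw [hφ.coeff_one, hψ.coeff_one]

theorem exists_endo (hR : IsLubinTateBase R p m) (a : R) : ∃ φ, IsLTEndo p (p ^ m) a φ := by
  obtain ⟨F, h0, h1, h2⟩ := hR.exists_series (σ := Unit) (L := (C a * X : R⟦X⟧)) (by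
    change PowerSeries.constantCoeff (C a * X : R⟦X⟧) = 0
    simp)
  refine ⟨F, ⟨h0, h2⟩, ?_⟩
  refine (h1 (Finsupp.single () 1) (by simp)).trans ?_
  change coeff 1 (C a * X : R⟦X⟧) = a
  simp

theorem comp (hq : q ≠ 0) (hφ : IsLTEndo p q a φ) (hψ : IsLTEndo p q b ψ) :
    IsLTEndo p q (a * b) (φ.subst ψ) := by
  refine ⟨hφ.commutes.subst hq fun _ => hψ.commutes, ?_⟩
  obtain ⟨φ', rfl⟩ := X_dvd_iff.mpr hφ.constantCoeff
  have hs := hψ.hasSubst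
  rw [subst_mul hs, subst_X hs]
  obtain ⟨ψ', hψ'⟩ := X_dvd_iff.mpr hψ.constantCoeff
  have h1 : PowerSeries.constantCoeff (subst ψ φ') = PowerSeries.constantCoeff φ' :=
    MvPowerSeries.constantCoeff_subst_of_constantCoeff_zero (σ := Unit)
      (fun _ => hψ.constantCoeff) φ'
  have h2 := hφ.coeff_one
  have h3 := hψ.coeff_one
  rw [coeff_one_X_mul] at h2
  have h4 : ψ * subst ψ φ' = X * (ψ' * subst ψ φ') := by rw [← mul_assoc, ← hψ']
  rw [h4, coeff_one_X_mul, map_mul, h1, h2]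
  rw [hψ', coeff_one_X_mul] at h3
  rw [h3, mul_comm]

/-- The series p X + X ^ q has integer coefficients, so every ring homomorphism preserves it. For a
Galois automorphism this is the source of the twist in the semidirect product. -/
theorem map {S : Type*} [CommRing S] (hq : q ≠ 0) (f : R →+* S) (hφ : IsLTEndo p q a φ) :
    IsLTEndo p q (f a) (PowerSeries.map f φ) := by
  refine ⟨⟨?_, ?_⟩, by rw [coeff_map, hφ.coeff_one]⟩
  · change PowerSeries.constantCoeff (PowerSeries.map f φ) = 0
    rw [← coeff_zero_eq_constantCoeff_apply, coeff_map, coeff_zero_eq_constantCoeff_apply,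
      hφ.constantCoeff, map_zero]
  · have h1 := congrArg (MvPowerSeries.map f) hφ.commutes.2
    rw [MvPowerSeries.map_subst (hasSubst_ltFamily hq), map_add, map_mul, map_pow,
      MvPowerSeries.map_C, map_natCast] at h1
    rw [← show (fun i => MvPowerSeries.map f (ltFamily R p q i)) = ltFamily (σ := Unit) S p q from ?_]
    · exact h1
    · funext i
      simp [ltFamily]

/-- Teichmüller elements act linearly; this makes the first level of the Tate module explicit. -/
theorem C_mul_X (hq : q ≠ 0) (ha : a ^ q = a) : IsLTEndo p q a (C a * X) := by
  refine ⟨⟨?_, ?_⟩, by simp⟩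
  · change PowerSeries.constantCoeff (C a * X : R⟦X⟧) = 0
    simp
  · change MvPowerSeries.subst (ltFamily R p q) (MvPowerSeries.C a * MvPowerSeries.X ()) =
      MvPowerSeries.C (p : R) * (MvPowerSeries.C a * MvPowerSeries.X ()) +
        (MvPowerSeries.C a * MvPowerSeries.X ()) ^ q
    have hs := hasSubst_ltFamily (R := R) (σ := Unit) (p := p) hq
    rw [MvPowerSeries.subst_mul hs, MvPowerSeries.subst_C, MvPowerSeries.subst_X hs, ltFamily,
      mul_pow, ← map_pow, ha]
    ring

theorem natCast (hq : 2 ≤ q) : IsLTEndo p q (p : R) (C (p : R) * X + X ^ q) := by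
  have h0 : PowerSeries.constantCoeff (C (p : R) * X + X ^ q : R⟦X⟧) = 0 := by
    simp [show q ≠ 0 by omega]
  refine ⟨⟨h0, ?_⟩, ?_⟩
  · set f : R⟦X⟧ := C (p : R) * X + X ^ q with hf
    have hs : HasSubst f := HasSubst.of_constantCoeff_zero' h0
    change PowerSeries.subst f f = C (p : R) * f + f ^ q
    conv_lhs => rw [hf, subst_add hs, subst_mul hs, subst_pow hs, subst_X hs, subst_C]
    rfl
  · rw [map_add, coeff_C_mul, coeff_one_X, mul_one, coeff_X_pow, if_neg (by omega), add_zero]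

/-- `[1 + c](X) = X + [c](X) U(X)` with `U ≡ 1`: a consequence of the existence of the Lubin-Tate
formal group law. -/
theorem exists_one_add (hR : IsLubinTateBase R p m) (hφ : IsLTEndo p (p ^ m) (1 + c) φ)
    (hψ : IsLTEndo p (p ^ m) c ψ) :
    ∃ U : R⟦X⟧, PowerSeries.constantCoeff U = 1 ∧ φ = X + ψ * U := by
  classical
  have hq : p ^ m ≠ 0 := pow_ne_zero _ hR.prime.ne_zero
  -- F is the formal group law. Only its linear part, its commutation with [p] and F(X, 0) = X are
  -- needed; associativity and commutativity are not.
  obtain ⟨F, hF0, hF1, hF2⟩ := hR.exists_series (σ := Fin 2)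
    (L := MvPowerSeries.X 0 + MvPowerSeries.X 1) (by simp)
  have hF : CommutesLT p (p ^ m) F := ⟨hF0, hF2⟩
  have hX : CommutesLT (σ := Unit) p (p ^ m) (X : R⟦X⟧) := CommutesLT.X hq ()
  have hc0 : ∀ i, CommutesLT (σ := Unit) p (p ^ m) ((![X, 0] : Fin 2 → R⟦X⟧) i) := by
    intro i
    fin_cases i
    · exact hX
    · exact CommutesLT.zero hq
  have hs0 : MvPowerSeries.HasSubst (![X, 0] : Fin 2 → MvPowerSeries Unit R) :=
    MvPowerSeries.hasSubst_of_constantCoeff_zero fun i => (hc0 i).1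
  have hcoeff (n : ℕ) : coeff n (MvPowerSeries.subst (![X, 0] : Fin 2 → R⟦X⟧) F : R⟦X⟧) =
      MvPowerSeries.coeff (Finsupp.single 0 n) F := by
    refine (MvPowerSeries.coeff_subst hs0 F _).trans ?_
    rw [finsum_eq_single _ (Finsupp.single 0 n)]
    · rw [Finsupp.prod_fintype _ _ (fun i => pow_zero _), Fin.prod_univ_two]
      change _ • coeff n ((X : R⟦X⟧) ^ (Finsupp.single (0 : Fin 2) n 0) *
        (0 : R⟦X⟧) ^ (Finsupp.single (0 : Fin 2) n 1)) = _
      rw [Finsupp.single_eq_same, Finsupp.single_eq_of_ne (by decide), pow_zero, mul_one,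
        coeff_X_pow_self, smul_eq_mul, mul_one]
    · intro d hd
      rw [Finsupp.prod_fintype _ _ (fun i => pow_zero _), Fin.prod_univ_two]
      change _ • coeff n ((X : R⟦X⟧) ^ d 0 * (0 : R⟦X⟧) ^ d 1) = 0
      by_cases h1 : d 1 = 0
      · rw [h1, pow_zero, mul_one, coeff_X_pow, if_neg, smul_zero]
        intro h
        apply hd
        ext i
        fin_cases i
        · simp [h]
        · simp [h1]
      · rw [zero_pow h1, mul_zero, map_zero, smul_zero]
  have hFX : (MvPowerSeries.subst (![X, 0] : Fin 2 → R⟦X⟧) F : R⟦X⟧) = X := by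
    refine unique hR (a := 1) ⟨hF.subst hq hc0, ?_⟩ ⟨hX, coeff_one_X⟩
    rw [hcoeff, hF1 _ (by simp), map_add, MvPowerSeries.coeff_X, MvPowerSeries.coeff_X,
      if_pos rfl, if_neg, add_zero]
    rw [Finsupp.single_left_inj one_ne_zero]
    exact zero_ne_one
  -- F(X, 0) = X says that F = X₀ + X₁ G; putting X₀ = X and X₁ = [c](X) will give the factor U.
  obtain ⟨G, hG⟩ : (MvPowerSeries.X 1 : MvPowerSeries (Fin 2) R) ∣ F - MvPowerSeries.X 0 := by
    rw [MvPowerSeries.X_dvd_iff]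
    intro d hd
    obtain ⟨n, rfl⟩ : ∃ n, d = Finsupp.single 0 n := ⟨d 0, by
      ext i
      fin_cases i
      · simp
      · simp [hd]⟩
    rw [map_sub, ← hcoeff, hFX, MvPowerSeries.coeff_X, coeff_X]
    by_cases hn : n = 1
    · simp [hn]
    · rw [if_neg hn, if_neg, sub_zero]
      rwa [(Finsupp.single_injective _).eq_iff]
  have hG0 : MvPowerSeries.constantCoeff G = 1 := by
    have h1 := congrArg (MvPowerSeries.coeff (Finsupp.single 1 1)) hG
    rw [map_sub, hF1 _ (by simp), map_add, add_sub_cancel_left, MvPowerSeries.coeff_X,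
      if_pos rfl] at h1
    have h2 := MvPowerSeries.coeff_add_monomial_mul (Finsupp.single (1 : Fin 2) 1) 0 G (1 : R)
    rw [add_zero, one_mul, MvPowerSeries.coeff_zero_eq_constantCoeff_apply] at h2
    rw [← h2]
    exact h1.symm
  have hc : ∀ i, CommutesLT (σ := Unit) p (p ^ m) ((![X, ψ] : Fin 2 → R⟦X⟧) i) := by
    intro i
    fin_cases i
    · exact hX
    · exact hψ.commutes
  have hs : MvPowerSeries.HasSubst (![X, ψ] : Fin 2 → MvPowerSeries Unit R) :=
    MvPowerSeries.hasSubst_of_constantCoeff_zero fun i => (hc i).1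
  let U : R⟦X⟧ := MvPowerSeries.subst (![X, ψ] : Fin 2 → R⟦X⟧) G
  have hU : PowerSeries.constantCoeff U = 1 :=
    (MvPowerSeries.constantCoeff_subst_of_constantCoeff_zero (fun i => (hc i).1) G).trans hG0
  have hFU : (MvPowerSeries.subst (![X, ψ] : Fin 2 → R⟦X⟧) F : R⟦X⟧) = X + ψ * U := by
    rw [sub_eq_iff_eq_add'.mp hG, MvPowerSeries.subst_add hs, MvPowerSeries.subst_mul hs,
      MvPowerSeries.subst_X hs, MvPowerSeries.subst_X hs]
    rfl
  refine ⟨U, hU, unique hR hφ ?_⟩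
  rw [← hFU]
  refine ⟨hF.subst hq hc, ?_⟩
  rw [hFU]
  obtain ⟨ψ', hψ'⟩ := X_dvd_iff.mpr hψ.constantCoeff
  have h3 := hψ.coeff_one
  rw [hψ', coeff_one_X_mul] at h3
  rw [map_add, coeff_one_X, hψ', mul_assoc, coeff_one_X_mul, map_mul, hU, h3, mul_one]

end IsLTEndo

end LubinTateEndo

/-! ### Arithmetic of `Z_{p²}`: units, Teichmüller representatives, completeness. -/

section IntegerRing

variable {p : ℕ} [Fact p.Prime] {d : ℤ_[p]} {δ : Zp2 p}

theorem three_le_sq_sub_one (p : ℕ) [Fact p.Prime] : 3 ≤ p ^ 2 - 1 := by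
  have := (Fact.out : p.Prime).two_le
  have : 2 * 2 ≤ p ^ 2 := by nlinarith
  omega

theorem natCast_Zp2_ne_zero : (p : Zp2 p) ≠ 0 := by
  have h : algebraMap ℤ_[p] (Zp2 p) p ≠ algebraMap ℤ_[p] (Zp2 p) 0 :=
    algebraMap_Zp2_injective.ne (by exact_mod_cast (Fact.out : p.Prime).ne_zero)
  simpa using h

theorem exists_primitiveRoot_Zp2 : ∃ ζ : Zp2 p, IsPrimitiveRoot ζ (p ^ 2 - 1) := by
  have h3 := three_le_sq_sub_one p
  have : NeZero (p ^ 2 - 1) := ⟨by omega⟩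
  obtain ⟨ζ, hζ⟩ := HasEnoughRootsOfUnity.exists_primitiveRoot (PadicAlgCl p) (p ^ 2 - 1)
  let ζ' : Qp2 p := ⟨ζ, IntermediateField.subset_adjoin _ _ hζ.pow_eq_one⟩
  have hζ' : ζ' ^ (p ^ 2 - 1) = 1 := Subtype.ext hζ.pow_eq_one
  have hint : IsIntegral ℤ_[p] ζ' := by
    refine IsIntegral.of_pow (n := p ^ 2 - 1) (by omega) ?_
    rw [hζ']; exact isIntegral_one
  refine ⟨⟨ζ', hint⟩, ?_⟩
  refine IsPrimitiveRoot.of_map_of_injective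
    (f := (Qp2 p).val.toRingHom.comp (Zp2 p).val.toRingHom) ?_ ?_
  · exact hζ
  · exact Subtype.val_injective.comp Subtype.val_injective

namespace IsSqrtGenerator

theorem isUnit_of_norm (h : IsSqrtGenerator p d δ) {x y : ℤ_[p]}
    (hu : IsUnit (x ^ 2 - d * y ^ 2)) : IsUnit (algebraMap ℤ_[p] (Zp2 p) x + algebraMap _ _ y * δ) := by
  refine isUnit_of_mul_isUnit_left
    (y := algebraMap ℤ_[p] (Zp2 p) x - algebraMap _ _ y * δ) ?_
  have h1 := hu.map (algebraMap ℤ_[p] (Zp2 p))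
  convert h1 using 1
  simp only [map_sub, map_mul, map_pow]
  linear_combination (-(algebraMap ℤ_[p] (Zp2 p) y) ^ 2) * h.sq_eq

/-- The norm to `Z_p` is congruent to 1 modulo p, hence a unit of the local ring `Z_p`. -/
theorem isUnit_one_add (h : IsSqrtGenerator p d δ) (z : Zp2 p) : IsUnit (1 + (p : Zp2 p) * z) := by
  obtain ⟨a, b, rfl⟩ := h.exists_coord z
  have h1 := h.isUnit_of_norm (x := 1 + p * a) (y := p * b) (by
    have : (1 + (p : ℤ_[p]) * a) ^ 2 - d * (p * b) ^ 2 =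
        1 - -(p * (2 * a + p * a ^ 2 - d * p * b ^ 2)) := by ring
    rw [this]
    refine IsLocalRing.isUnit_one_sub_self_of_mem_nonunits _ ?_
    rw [← mul_neg]
    exact mul_mem_nonunits_left PadicInt.p_nonunit)
  convert h1 using 1
  simp only [map_add, map_mul, map_one, map_natCast]
  ring

theorem not_isUnit_natCast (h : IsSqrtGenerator p d δ) : ¬ IsUnit (p : Zp2 p) := by
  intro hu
  obtain ⟨z, hz⟩ := hu.exists_right_inv
  have h1 := h.isUnit_one_add (-z)
  rw [mul_neg, hz, add_neg_cancel] at h1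
  exact not_isUnit_zero h1

theorem not_dvd_of_isUnit (h : IsSqrtGenerator p d δ) {z : Zp2 p} (hz : IsUnit z) :
    ¬ (p : Zp2 p) ∣ z := fun hd => h.not_isUnit_natCast (isUnit_of_dvd_unit hd hz)

/-- Distinct solutions of `t ^ q = t` are distinct modulo `p`. -/
theorem isUnit_sub_of_pow_eq (h : IsSqrtGenerator p d δ) {t t' : Zp2 p} (ht : t ^ p ^ 2 = t)
    (ht' : t' ^ p ^ 2 = t') (hne : t ≠ t') : IsUnit (t - t') := by
  have hp := (Fact.out : p.Prime).two_le
  -- Since t ^ q - t' ^ q = t - t', the geometric sum is 1. It is congruent to q t ^ (q - 1) modulo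
  -- t - t', so t - t' divides the unit 1 - q t ^ (q - 1).
  have h1 := (Commute.all t t').mul_geom_sum₂ (p ^ 2)
  rw [ht, ht'] at h1
  have h2 : ∑ i ∈ Finset.range (p ^ 2), t ^ i * t' ^ (p ^ 2 - 1 - i) = 1 :=
    mul_left_cancel₀ (sub_ne_zero.mpr hne) (by rw [h1, mul_one])
  have h3 : (t - t') ∣ ∑ i ∈ Finset.range (p ^ 2), t ^ i * t' ^ (p ^ 2 - 1 - i) -
      ∑ i ∈ Finset.range (p ^ 2), t ^ (p ^ 2 - 1) := by
    rw [← Finset.sum_sub_distrib]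
    refine Finset.dvd_sum fun i hi => ?_
    rw [Finset.mem_range] at hi
    have : t ^ (p ^ 2 - 1) = t ^ i * t ^ (p ^ 2 - 1 - i) := by
      rw [← pow_add]; congr 1; omega
    rw [this, ← mul_sub, ← neg_sub (t ^ _), mul_neg, dvd_neg]
    exact (sub_dvd_pow_sub_pow t t' _).mul_left _
  rw [h2, Finset.sum_const, Finset.card_range, nsmul_eq_mul] at h3
  refine isUnit_of_dvd_unit h3 ?_
  have h4 := h.isUnit_one_add (-(p * t ^ (p ^ 2 - 1)))
  rw [show (1 : Zp2 p) - (p ^ 2 : ℕ) * t ^ (p ^ 2 - 1) = 1 + p * -(p * t ^ (p ^ 2 - 1)) by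
    push_cast; ring]
  exact h4

theorem eq_of_dvd_sub (h : IsSqrtGenerator p d δ) {t t' : Zp2 p} (ht : t ^ p ^ 2 = t)
    (ht' : t' ^ p ^ 2 = t') (hd : (p : Zp2 p) ∣ t - t') : t = t' := by
  by_contra hne
  exact h.not_dvd_of_isUnit (h.isUnit_sub_of_pow_eq ht ht' hne) hd

/-- The residue map in coordinates. -/
noncomputable def residue (h : IsSqrtGenerator p d δ) (z : Zp2 p) : ZMod p × ZMod p :=
  (PadicInt.toZMod (h.basis.repr z 0), PadicInt.toZMod (h.basis.repr z 1))

theorem dvd_sub_of_residue_eq (h : IsSqrtGenerator p d δ) {z w : Zp2 p}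
    (hzw : h.residue z = h.residue w) : (p : Zp2 p) ∣ z - w := by
  have key {x y : ℤ_[p]} (hxy : PadicInt.toZMod x = PadicInt.toZMod y) :
      (p : Zp2 p) ∣ algebraMap ℤ_[p] (Zp2 p) x - algebraMap ℤ_[p] (Zp2 p) y := by
    have h1 : x - y ∈ RingHom.ker (PadicInt.toZMod (p := p)) := by
      rw [RingHom.mem_ker, map_sub, hxy, sub_self]
    rw [PadicInt.ker_toZMod, PadicInt.maximalIdeal_eq_span_p, Ideal.mem_span_singleton] at h1
    simpa using map_dvd (algebraMap ℤ_[p] (Zp2 p)) h1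
  rw [residue, residue, Prod.mk.injEq] at hzw
  rw [h.eq_coord z, h.eq_coord w]
  have h2 := dvd_add (key hzw.1) ((key hzw.2).mul_right δ)
  convert h2 using 1
  ring

/-- A finite set of `q` Teichmüller representatives. -/
theorem exists_teichmuller_finset (h : IsSqrtGenerator p d δ) :
    ∃ T : Finset (Zp2 p), T.card = p ^ 2 ∧ (∀ t ∈ T, t ^ p ^ 2 = t) ∧
      ∀ c : Zp2 p, ∃ t ∈ T, (p : Zp2 p) ∣ c - t := by
  classical
  have h3 := three_le_sq_sub_one p
  obtain ⟨ζ, hζ⟩ := exists_primitiveRoot_Zp2 (p := p)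
  let T : Finset (Zp2 p) := insert 0 ((Finset.range (p ^ 2 - 1)).image (ζ ^ ·))
  have hcard : T.card = p ^ 2 := by
    rw [Finset.card_insert_of_notMem, Finset.card_image_of_injOn, Finset.card_range]
    · omega
    · intro i hi j hj hij
      exact hζ.pow_inj (by simpa using hi) (by simpa using hj) hij
    · simp only [Finset.mem_image, not_exists, not_and]
      intro i _
      exact pow_ne_zero _ (hζ.ne_zero (by omega))
  have hT : ∀ t ∈ T, t ^ p ^ 2 = t := by
    intro t ht
    rcases Finset.mem_insert.mp ht with rfl | ht
    · exact zero_pow (by omega)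
    · obtain ⟨i, -, rfl⟩ := Finset.mem_image.mp ht
      have : p ^ 2 = p ^ 2 - 1 + 1 := by omega
      rw [← pow_mul, mul_comm, pow_mul, this, pow_succ, hζ.pow_eq_one, one_mul]
  refine ⟨T, hcard, hT, fun c => ?_⟩
  -- The p ^ 2 representatives have distinct residues in a set with p ^ 2 elements, so every residue
  -- is attained.
  have huniv : T.image h.residue = Finset.univ := by
    apply Finset.eq_univ_of_card
    rw [Finset.card_image_of_injOn, hcard, Fintype.card_prod, ZMod.card, sq]
    intro t ht t' ht' htt
    exact h.eq_of_dvd_sub (hT t ht) (hT t' ht') (h.dvd_sub_of_residue_eq htt)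
  have hc : h.residue c ∈ T.image h.residue := by rw [huniv]; exact Finset.mem_univ _
  obtain ⟨t, ht, htc⟩ := Finset.mem_image.mp hc
  exact ⟨t, ht, h.dvd_sub_of_residue_eq htc.symm⟩

theorem isLubinTateBase (h : IsSqrtGenerator p d δ) : IsLubinTateBase (Zp2 p) p 2 where
  prime := Fact.out
  pos := two_ne_zero
  cancel _ _ := mul_left_cancel₀ natCast_Zp2_ne_zero
  isUnit n hn := by
    obtain ⟨k, rfl⟩ := Nat.exists_eq_succ_of_ne_zero hn
    have := h.isUnit_one_add (-(p : Zp2 p) ^ k)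
    convert this using 1
    rw [pow_succ]
    ring
  dvd c := by
    obtain ⟨T, -, hT, hTc⟩ := h.exists_teichmuller_finset
    obtain ⟨t, ht, htc⟩ := hTc c
    have h1 := htc.trans (sub_dvd_pow_sub_pow c t (p ^ 2))
    rw [hT t ht] at h1
    have h2 := dvd_sub h1 htc
    rwa [sub_sub_sub_cancel_right] at h2

theorem isUnit_of_pow_eq {t : Zp2 p} (ht : t ^ p ^ 2 = t) (h0 : t ≠ 0) : t ^ (p ^ 2 - 1) = 1 := by
  have h3 := three_le_sq_sub_one p
  have : p ^ 2 = p ^ 2 - 1 + 1 := by omega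
  rw [this, pow_succ] at ht
  exact mul_right_cancel₀ h0 (ht.trans (one_mul t).symm)

theorem pow_eq_of_pow_eq_one {t : Zp2 p} (ht : t ^ (p ^ 2 - 1) = 1) : t ^ p ^ 2 = t := by
  have h3 := three_le_sq_sub_one p
  have : p ^ 2 = p ^ 2 - 1 + 1 := by omega
  rw [this, pow_succ, ht, one_mul]

theorem exists_isOmegaDiam (h : IsSqrtGenerator p d δ) (x : (Zp2 p)ˣ) :
    ∃ w y : (Zp2 p)ˣ, IsOmegaDiam x w y := by
  obtain ⟨T, -, hT, hTc⟩ := h.exists_teichmuller_finset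
  obtain ⟨t, ht, htc⟩ := hTc x
  have h3 := three_le_sq_sub_one p
  have h0 : t ≠ 0 := by
    rintro rfl
    rw [sub_zero] at htc
    exact h.not_dvd_of_isUnit x.isUnit htc
  have ht1 := isUnit_of_pow_eq (hT t ht) h0
  let w : (Zp2 p)ˣ := Units.ofPowEqOne t _ ht1 (by omega)
  refine ⟨w, w⁻¹ * x, by group, Units.pow_ofPowEqOne ht1 (by omega), ?_⟩
  obtain ⟨z, hz⟩ := htc
  refine ⟨(w⁻¹ : (Zp2 p)ˣ) * z, ?_⟩
  have hw : (w⁻¹ : (Zp2 p)ˣ) * t = 1 := w.inv_mul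
  rw [Units.val_mul]
  linear_combination ((w⁻¹ : (Zp2 p)ˣ) : Zp2 p) * hz + hw

theorem isOmegaDiam_unique (h : IsSqrtGenerator p d δ) {x w y w' y' : (Zp2 p)ˣ}
    (h1 : IsOmegaDiam x w y) (h2 : IsOmegaDiam x w' y') : w = w' ∧ y = y' := by
  have hw : w = w' := by
    apply Units.ext
    have e1 : (w : Zp2 p) ^ (p ^ 2 - 1) = 1 := by rw [← Units.val_pow_eq_pow_val, h1.2.1, Units.val_one]
    have e2 : (w' : Zp2 p) ^ (p ^ 2 - 1) = 1 := by rw [← Units.val_pow_eq_pow_val, h2.2.1, Units.val_one]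
    refine h.eq_of_dvd_sub (pow_eq_of_pow_eq_one e1) (pow_eq_of_pow_eq_one e2) ?_
    have e3 : (w : Zp2 p) * y = w' * y' := by
      rw [← Units.val_mul, ← Units.val_mul, ← h1.1, ← h2.1]
    have e4 := dvd_sub (h2.2.2.mul_left (w' : Zp2 p)) (h1.2.2.mul_left (w : Zp2 p))
    convert e4 using 1
    linear_combination e3
  refine ⟨hw, ?_⟩
  have := h1.1.symm.trans h2.1
  rw [hw] at this
  exact mul_left_cancel this

theorem existsUnique_isOmegaDiam (h : IsSqrtGenerator p d δ) (x : (Zp2 p)ˣ) :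
    ∃! wy : (Zp2 p)ˣ × (Zp2 p)ˣ, IsOmegaDiam x wy.1 wy.2 := by
  obtain ⟨w, y, hwy⟩ := h.exists_isOmegaDiam x
  refine ⟨(w, y), hwy, ?_⟩
  rintro ⟨w', y'⟩ h'
  have := h.isOmegaDiam_unique h' hwy
  exact Prod.ext this.1 this.2

/-- With t ≠ 0 the Teichmüller representative of c, the product c t ^ (q - 2) is congruent to t ^ (q
- 1) = 1 modulo p. -/
theorem isUnit_of_not_dvd (h : IsSqrtGenerator p d δ) {c : Zp2 p} (hc : ¬ (p : Zp2 p) ∣ c) :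
    IsUnit c := by
  have h3 := three_le_sq_sub_one p
  obtain ⟨T, -, hT, hTc⟩ := h.exists_teichmuller_finset
  obtain ⟨t, ht, z, hz⟩ := hTc c
  have h0 : t ≠ 0 := by
    rintro rfl
    exact hc ⟨z, by rw [← hz, sub_zero]⟩
  have ht1 := isUnit_of_pow_eq (hT t ht) h0
  have hct : c * t ^ (p ^ 2 - 2) = 1 + p * (z * t ^ (p ^ 2 - 2)) := by
    have : p ^ 2 - 1 = (p ^ 2 - 2) + 1 := by omega
    rw [this, pow_succ] at ht1
    linear_combination (t ^ (p ^ 2 - 2)) * hz + ht1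
  exact isUnit_of_mul_isUnit_left (hct ▸ h.isUnit_one_add _)

theorem exists_eq_pow_mul (h : IsSqrtGenerator p d δ) {c : Zp2 p} (hc : c ≠ 0) :
    ∃ (k : ℕ) (u : Zp2 p), IsUnit u ∧ c = (p : Zp2 p) ^ k * u := by
  have : Module.Finite ℤ_[p] (Zp2 p) := Module.Finite.of_basis h.basis
  have : IsNoetherianRing (Zp2 p) := IsNoetherianRing.of_finite ℤ_[p] (Zp2 p)
  obtain ⟨k, u, hu, rfl⟩ := WfDvdMonoid.max_power_factor' hc h.not_isUnit_natCast
  exact ⟨k, u, h.isUnit_of_not_dvd hu, rfl⟩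

theorem _root_.PadicInt.exists_limit (f : ℕ → ℤ_[p])
    (hf : ∀ k, (p : ℤ_[p]) ^ k ∣ f (k + 1) - f k) : ∃ L, ∀ k, (p : ℤ_[p]) ^ k ∣ L - f k := by
  have hmem (k : ℕ) (x y : ℤ_[p]) :
      x ≡ y [SMOD (IsLocalRing.maximalIdeal ℤ_[p] ^ k • ⊤ : Ideal ℤ_[p])] ↔
        (p : ℤ_[p]) ^ k ∣ x - y := by
    rw [SModEq.sub_mem, PadicInt.maximalIdeal_eq_span_p, Ideal.span_singleton_pow, smul_eq_mul,
      Ideal.mul_top, Ideal.mem_span_singleton]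
  obtain ⟨L, hL⟩ := IsPrecomplete.prec' (I := IsLocalRing.maximalIdeal ℤ_[p]) f (by
    intro m n hmn
    rw [hmem]
    induction n, hmn using Nat.le_induction with
    | base => simp
    | succ n hmn ih =>
      have h1 := (pow_dvd_pow (p : ℤ_[p]) hmn).trans (hf n)
      have h2 := dvd_sub ih h1
      convert h2 using 1
      ring)
  refine ⟨L, fun k => ?_⟩
  rw [← hmem]
  exact (hL k).symm

/-- Completeness passes from `Z_p` through the coordinates on 1, √d. -/
theorem exists_limit (h : IsSqrtGenerator p d δ) (f : ℕ → Zp2 p)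
    (hf : ∀ k, (p : Zp2 p) ^ k ∣ f (k + 1) - f k) : ∃ L, ∀ k, (p : Zp2 p) ^ k ∣ L - f k := by
  have hcoord (i : Fin 2) (k : ℕ) :
      (p : ℤ_[p]) ^ k ∣ h.basis.repr (f (k + 1)) i - h.basis.repr (f k) i := by
    obtain ⟨w, hw⟩ := hf k
    refine ⟨h.basis.repr w i, ?_⟩
    have : (p : Zp2 p) ^ k * w = (p : ℤ_[p]) ^ k • w := by
      rw [Algebra.smul_def, map_pow, map_natCast]
    rw [this] at hw
    rw [← Finsupp.sub_apply, ← map_sub, hw, map_smul, Finsupp.smul_apply, smul_eq_mul]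
  obtain ⟨x, hx⟩ := PadicInt.exists_limit _ (hcoord 0)
  obtain ⟨y, hy⟩ := PadicInt.exists_limit _ (hcoord 1)
  refine ⟨algebraMap _ _ x + algebraMap _ _ y * δ, fun k => ?_⟩
  rw [h.eq_coord (f k)]
  have h1 := map_dvd (algebraMap ℤ_[p] (Zp2 p)) (hx k)
  have h2 := map_dvd (algebraMap ℤ_[p] (Zp2 p)) (hy k)
  rw [map_pow, map_natCast, map_sub] at h1 h2
  have h3 := dvd_add h1 (h2.mul_right δ)
  convert h3 using 1
  ring

end IsSqrtGenerator

end IntegerRing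

/-! ### Evaluation of power series on the open unit disc. -/

section Evaluation

open PowerSeries

variable {R K : Type*} [CommRing R] [NormedField K] {ι : R →+* K} {x : K}

theorem summable_norm_eval (hι : ∀ r, ‖ι r‖ ≤ 1) (hx : ‖x‖ < 1) (φ : R⟦X⟧) :
    Summable fun k => ‖ι (coeff k φ) * x ^ k‖ := by
  refine Summable.of_nonneg_of_le (fun _ => norm_nonneg _) (fun k => ?_)
    (summable_geometric_of_lt_one (norm_nonneg x) hx)
  rw [norm_mul, norm_pow]
  exact mul_le_of_le_one_left (by positivity) (hι _)

/-- The open unit disc. -/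
abbrev Disc (K : Type*) [NormedField K] : Type _ := {x : K // ‖x‖ < 1}

instance : Zero (Disc K) := ⟨⟨0, by simp⟩⟩

@[simp] theorem Disc.coe_zero : ((0 : Disc K) : K) = 0 := rfl

variable [CompleteSpace K]

/-- Evaluation of power series with bounded coefficients at a point of the open unit disc. -/
noncomputable def evalHom (hι : ∀ r, ‖ι r‖ ≤ 1) (hx : ‖x‖ < 1) : R⟦X⟧ →+* K where
  toFun φ := ∑' k, ι (coeff k φ) * x ^ k
  map_one' := by
    rw [tsum_eq_single 0]
    · simp
    · intro k hk
      simp [coeff_one, hk]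
  map_zero' := by simp
  map_add' φ ψ := by
    rw [← (summable_norm_eval hι hx φ).of_norm.tsum_add (summable_norm_eval hι hx ψ).of_norm]
    congr 1
    funext k
    rw [map_add, map_add, add_mul]
  map_mul' φ ψ := by
    rw [tsum_mul_tsum_eq_tsum_sum_antidiagonal_of_summable_norm (summable_norm_eval hι hx φ)
      (summable_norm_eval hι hx ψ)]
    congr 1
    funext k
    rw [coeff_mul, map_sum, Finset.sum_mul]
    refine Finset.sum_congr rfl fun ij hij => ?_
    rw [map_mul, ← Finset.HasAntidiagonal.mem_antidiagonal.mp hij, pow_add]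
    ring

theorem hasSum_evalHom (hι : ∀ r, ‖ι r‖ ≤ 1) (hx : ‖x‖ < 1) (φ : R⟦X⟧) :
    HasSum (fun k => ι (coeff k φ) * x ^ k) (evalHom hι hx φ) :=
  (summable_norm_eval hι hx φ).of_norm.hasSum

theorem evalHom_C (hι : ∀ r, ‖ι r‖ ≤ 1) (hx : ‖x‖ < 1) (r : R) : evalHom hι hx (C r) = ι r := by
  refine (hasSum_evalHom hι hx (C r)).unique ?_
  convert hasSum_single (α := K) 0 fun k hk => ?_ using 1
  · simp
  · simp [coeff_C, hk]

theorem evalHom_X (hι : ∀ r, ‖ι r‖ ≤ 1) (hx : ‖x‖ < 1) : evalHom hι hx (X : R⟦X⟧) = x := by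
  refine (hasSum_evalHom hι hx (X : R⟦X⟧)).unique ?_
  convert hasSum_single (α := K) 1 fun k hk => ?_ using 1
  · simp
  · simp [coeff_X, hk]

variable [IsUltrametricDist K]

theorem norm_evalHom_le (hι : ∀ r, ‖ι r‖ ≤ 1) (hx : ‖x‖ < 1) (φ : R⟦X⟧) :
    ‖evalHom hι hx φ‖ ≤ 1 := by
  refine le_of_tendsto ((continuous_norm.tendsto _).comp (hasSum_evalHom hι hx φ))
    (Filter.Eventually.of_forall fun s => ?_)
  refine IsUltrametricDist.norm_sum_le_of_forall_le_of_nonneg zero_le_one fun k _ => ?_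
  rw [norm_mul, norm_pow]
  exact mul_le_one₀ (hι _) (by positivity) (pow_le_one₀ (norm_nonneg _) hx.le)

/-- Writing φ = X ψ + constant, the difference of the two values at φ is x times the difference at
ψ. Iterating, boundedness by 1 improves to ‖x‖ ^ n for every n. -/
theorem evalHom_unique (hι : ∀ r, ‖ι r‖ ≤ 1) (hx : ‖x‖ < 1) {E : R⟦X⟧ →+* K}
    (hE : ∀ φ, ‖E φ‖ ≤ 1) (hC : ∀ r, E (C r) = ι r) (hX : E X = x) (φ : R⟦X⟧) :
    E φ = evalHom hι hx φ := by
  have key (n : ℕ) : ∀ φ : R⟦X⟧, ‖E φ - evalHom hι hx φ‖ ≤ ‖x‖ ^ n := by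
    induction n with
    | zero =>
      intro φ
      rw [pow_zero]
      rw [sub_eq_add_neg]
      refine (IsUltrametricDist.norm_add_le_max _ _).trans (max_le (hE φ) ?_)
      rw [norm_neg]
      exact norm_evalHom_le hι hx φ
    | succ n ih =>
      intro φ
      rw [eq_X_mul_shift_add_const φ, map_add, map_add, map_mul, map_mul, hC, hX, evalHom_C,
        evalHom_X, add_sub_add_right_eq_sub, ← mul_sub, norm_mul, pow_succ']
      exact mul_le_mul_of_nonneg_left (ih _) (norm_nonneg _)
  rw [← sub_eq_zero, ← norm_le_zero_iff]
  exact ge_of_tendsto' (tendsto_pow_atTop_nhds_zero_of_lt_one (norm_nonneg x) hx) fun n => key n φ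

theorem norm_evalHom_le_norm (hι : ∀ r, ‖ι r‖ ≤ 1) (hx : ‖x‖ < 1) {φ : R⟦X⟧}
    (hφ : constantCoeff φ = 0) : ‖evalHom hι hx φ‖ ≤ ‖x‖ := by
  obtain ⟨ψ, rfl⟩ := X_dvd_iff.mpr hφ
  rw [map_mul, evalHom_X, norm_mul]
  exact mul_le_of_le_one_right (norm_nonneg _) (norm_evalHom_le hι hx ψ)

/-- No double series is rearranged: composing with ψ and then evaluating is a bounded ring
homomorphism with the right value at X, so `evalHom_unique` applies. -/
theorem evalHom_subst (hι : ∀ r, ‖ι r‖ ≤ 1) (hx : ‖x‖ < 1) {φ ψ : R⟦X⟧}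
    (hψ : constantCoeff ψ = 0) :
    evalHom hι hx (φ.subst ψ) =
      evalHom hι ((norm_evalHom_le_norm hι hx hψ).trans_lt hx) φ := by
  have hs : HasSubst ψ := HasSubst.of_constantCoeff_zero' hψ
  rw [← evalHom_unique hι ((norm_evalHom_le_norm hι hx hψ).trans_lt hx)
    (E := (evalHom hι hx).comp (substAlgHom hs).toRingHom)]
  · rw [← coe_substAlgHom hs]
    rfl
  · exact fun φ => norm_evalHom_le hι hx _
  · intro r
    rw [← evalHom_C hι hx]
    change evalHom hι hx (substAlgHom hs (C r)) = _
    rw [coe_substAlgHom hs, subst_C]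
    rfl
  · change evalHom hι hx (substAlgHom hs X) = _
    rw [substAlgHom_X]

theorem evalHom_ne_zero (hι : ∀ r, ‖ι r‖ ≤ 1) (hx : ‖x‖ < 1) {U : R⟦X⟧}
    (hU : constantCoeff U = 1) : evalHom hι hx U ≠ 0 := by
  intro h
  have h1 := norm_evalHom_le_norm hι hx (φ := U - 1) (by rw [map_sub, hU, map_one, sub_self])
  rw [map_sub, h, map_one, zero_sub, norm_neg, norm_one] at h1
  exact absurd hx h1.not_gt

namespace IsLTEndo

variable {p m : ℕ} {a b c : R} {φ ψ : R⟦X⟧}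

/-- Fixed points of `[1 + c]` are zeros of `[c]`. -/
theorem eval_eq_zero_of_one_add (hR : IsLubinTateBase R p m) (hι : ∀ r, ‖ι r‖ ≤ 1) (hx : ‖x‖ < 1)
    (hφ : IsLTEndo p (p ^ m) (1 + c) φ) (hψ : IsLTEndo p (p ^ m) c ψ) :
    evalHom hι hx φ = x ↔ evalHom hι hx ψ = 0 := by
  obtain ⟨U, hU, rfl⟩ := exists_one_add hR hφ hψ
  rw [map_add, map_mul, evalHom_X, add_eq_left, mul_eq_zero,
    or_iff_left (evalHom_ne_zero hι hx hU)]

end IsLTEndo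

namespace IsLubinTateBase

variable {p m : ℕ} (hR : IsLubinTateBase R p m) (hι : ∀ r, ‖ι r‖ ≤ 1)

/-- The series `[a](X)`. -/
noncomputable def endo (a : R) : R⟦X⟧ := (IsLTEndo.exists_endo hR a).choose

theorem isLTEndo_endo (a : R) : IsLTEndo p (p ^ m) a (hR.endo a) :=
  (IsLTEndo.exists_endo hR a).choose_spec

/-- Multiplication by `a` on the Lubin-Tate module. -/
noncomputable def act (a : R) (x : Disc K) : Disc K :=
  ⟨evalHom hι x.2 (hR.endo a),
    (norm_evalHom_le_norm hι x.2 (hR.isLTEndo_endo a).constantCoeff).trans_lt x.2⟩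

variable {hR hι}

theorem coe_act {a : R} {φ : R⟦X⟧} (hφ : IsLTEndo p (p ^ m) a φ) (x : Disc K) :
    (hR.act hι a x : K) = evalHom hι x.2 φ := by
  rw [IsLTEndo.unique hR hφ (hR.isLTEndo_endo a)]
  rfl

theorem act_mul (a b : R) (x : Disc K) :
    hR.act hι (a * b) x = hR.act hι a (hR.act hι b x) := by
  apply Subtype.ext
  rw [coe_act ((hR.isLTEndo_endo a).comp (pow_ne_zero _ hR.prime.ne_zero) (hR.isLTEndo_endo b)),
    evalHom_subst hι x.2 (hR.isLTEndo_endo b).constantCoeff]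
  rfl

theorem coe_act_natCast (x : Disc K) :
    (hR.act hι (p : R) x : K) = p * (x : K) + (x : K) ^ p ^ m := by
  rw [coe_act (IsLTEndo.natCast hR.two_le), map_add, map_mul, map_pow, evalHom_C, evalHom_X,
    map_natCast]

theorem coe_act_of_pow_eq {t : R} (ht : t ^ p ^ m = t) (x : Disc K) :
    (hR.act hι t x : K) = ι t * x := by
  rw [coe_act (IsLTEndo.C_mul_X (pow_ne_zero _ hR.prime.ne_zero) ht), map_mul, evalHom_C, evalHom_X]

theorem act_one (x : Disc K) : hR.act hι 1 x = x := by
  apply Subtype.ext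
  rw [coe_act_of_pow_eq (one_pow _), map_one, one_mul]

theorem act_zero (a : R) : hR.act hι a (0 : Disc K) = 0 := by
  apply Subtype.ext
  rw [Disc.coe_zero, ← norm_le_zero_iff]
  refine (norm_evalHom_le_norm hι (0 : Disc K).2 (hR.isLTEndo_endo a).constantCoeff).trans ?_
  simp

theorem act_one_add_eq_self_iff {c : R} {x : Disc K} :
    hR.act hι (1 + c) x = x ↔ hR.act hι c x = 0 := by
  rw [Subtype.ext_iff, Subtype.ext_iff]
  exact IsLTEndo.eval_eq_zero_of_one_add hR hι x.2 (hR.isLTEndo_endo _) (hR.isLTEndo_endo _)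

theorem act_inv_act {a b : R} (hab : a * b = 1) (x : Disc K) :
    hR.act hι a (hR.act hι b x) = x := by
  rw [← act_mul, hab, act_one]

theorem act_injective {a : R} (ha : IsUnit a) : Function.Injective (hR.act hι a : Disc K → _) := by
  obtain ⟨b, hb⟩ := ha.exists_left_inv
  exact Function.LeftInverse.injective (act_inv_act hb)

end IsLubinTateBase

end Evaluation

/-! ### Norm estimates in the algebraic closure and the passage to `ℂ_[p]`. -/

section Norms

variable {p : ℕ} [Fact p.Prime] {d : ℤ_[p]} {δ : Zp2 p}

theorem norm_natCast_algCl_lt_one : ‖(p : PadicAlgCl p)‖ < 1 := by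
  rw [← map_natCast (algebraMap ℚ_[p] (PadicAlgCl p)), PadicAlgCl.norm_extends]
  exact Padic.norm_p_lt_one

theorem norm_algebraMap_padicInt (c : ℤ_[p]) :
    ‖Zp2.toAlgCl p (algebraMap ℤ_[p] (Zp2 p) c)‖ = ‖c‖ :=
  PadicAlgCl.norm_extends p (c : ℚ_[p])

/-- The inclusion of `Z_{p²}` in the algebraic closure, as a ring homomorphism. -/
noncomputable def Zp2.toAlgClHom (p : ℕ) [Fact p.Prime] : Zp2 p →+* PadicAlgCl p :=
  (Qp2 p).val.toRingHom.comp (Zp2 p).val.toRingHom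

theorem Zp2.toAlgClHom_apply (a : Zp2 p) : Zp2.toAlgClHom p a = Zp2.toAlgCl p a := rfl

theorem Zp2.toAlgClHom_injective : Function.Injective (Zp2.toAlgClHom p) :=
  Subtype.val_injective.comp Subtype.val_injective

theorem IsSqrtGenerator.norm_le_one (h : IsSqrtGenerator p d δ) (z : Zp2 p) :
    ‖Zp2.toAlgCl p z‖ ≤ 1 := by
  have hδ : ‖Zp2.toAlgClHom p δ‖ ≤ 1 := by
    have h1 : ‖Zp2.toAlgClHom p (δ ^ 2)‖ ≤ 1 := by
      rw [h.sq_eq, Zp2.toAlgClHom_apply, norm_algebraMap_padicInt]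
      exact PadicInt.norm_le_one d
    rw [map_pow, norm_pow] at h1
    exact (pow_le_one_iff_of_nonneg (norm_nonneg _) two_ne_zero).mp h1
  obtain ⟨x, y, rfl⟩ := h.exists_coord z
  rw [← Zp2.toAlgClHom_apply, map_add, map_mul]
  refine (IsUltrametricDist.norm_add_le_max _ _).trans (max_le ?_ ?_)
  · rw [Zp2.toAlgClHom_apply, norm_algebraMap_padicInt]
    exact PadicInt.norm_le_one x
  · rw [norm_mul, Zp2.toAlgClHom_apply, norm_algebraMap_padicInt]
    exact mul_le_one₀ (PadicInt.norm_le_one y) (norm_nonneg _) hδ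

/-- The inclusion of `Z_{p²}` in the field of `p`-adic complex numbers. -/
noncomputable def Zp2.toComplex (p : ℕ) [Fact p.Prime] : Zp2 p →+* ℂ_[p] :=
  (algebraMap (PadicAlgCl p) ℂ_[p]).comp (Zp2.toAlgClHom p)

theorem Zp2.toComplex_apply (a : Zp2 p) : Zp2.toComplex p a = ((Zp2.toAlgCl p a : PadicAlgCl p) : ℂ_[p]) :=
  rfl

theorem IsSqrtGenerator.norm_toComplex_le (h : IsSqrtGenerator p d δ) (z : Zp2 p) :
    ‖Zp2.toComplex p z‖ ≤ 1 := by
  rw [Zp2.toComplex_apply, PadicComplex.norm_extends]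
  exact h.norm_le_one z

/-- If ‖t‖ ≥ 1, then t ^ q strictly dominates p t and the sum has norm at least 1. It follows by
induction that Tate generators lie in the open disc. -/
theorem norm_lt_one_of_norm_lubinTate {t : PadicAlgCl p}
    (ht : ‖(p : PadicAlgCl p) * t + t ^ (p ^ 2)‖ < 1) : ‖t‖ < 1 := by
  have hp := (Fact.out : p.Prime)
  by_contra! h1
  have h2 : ‖(p : PadicAlgCl p) * t‖ < ‖t ^ (p ^ 2)‖ := by
    rw [norm_mul, norm_pow]
    calc ‖(p : PadicAlgCl p)‖ * ‖t‖ < 1 * ‖t‖ :=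
          mul_lt_mul_of_pos_right norm_natCast_algCl_lt_one (by linarith)
      _ = ‖t‖ := one_mul _
      _ ≤ ‖t‖ ^ p ^ 2 := le_self_pow₀ h1 (pow_ne_zero _ hp.ne_zero)
  rw [IsUltrametricDist.norm_add_eq_max_of_norm_ne_norm h2.ne, max_eq_right h2.le, norm_pow] at ht
  exact absurd (one_le_pow₀ h1) ht.not_ge

end Norms

/-! ### The Tate module is free of rank one. -/

section TateModule

variable {p : ℕ} [Fact p.Prime] {d : ℤ_[p]} {δ : Zp2 p}

namespace IsSqrtGenerator

variable (h : IsSqrtGenerator p d δ)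

/-- Multiplication by `a` on the points of the Lubin-Tate module. -/
noncomputable def act (a : Zp2 p) (x : Disc ℂ_[p]) : Disc ℂ_[p] :=
  h.isLubinTateBase.act h.norm_toComplex_le a x

/-- Generators of the Tate module, as sequences of points of the unit disc. -/
structure IsTate (e : ℕ → Disc ℂ_[p]) : Prop where
  zero : e 0 = 0
  one_ne_zero : e 1 ≠ 0
  step : ∀ n, h.act p (e (n + 1)) = e n

variable {h} {e e' : ℕ → Disc ℂ_[p]}

theorem act_mul (a b : Zp2 p) (x : Disc ℂ_[p]) : h.act (a * b) x = h.act a (h.act b x) :=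
  IsLubinTateBase.act_mul a b x

theorem act_zero (a : Zp2 p) : h.act a 0 = 0 := IsLubinTateBase.act_zero a

theorem act_one (x : Disc ℂ_[p]) : h.act 1 x = x := IsLubinTateBase.act_one x

theorem act_injective {a : Zp2 p} (ha : IsUnit a) : Function.Injective (h.act a) :=
  IsLubinTateBase.act_injective ha

theorem act_eq_zero_iff {a : Zp2 p} (ha : IsUnit a) {x : Disc ℂ_[p]} : h.act a x = 0 ↔ x = 0 :=
  ⟨fun hx => act_injective ha (hx.trans (act_zero a).symm), fun hx => by rw [hx, act_zero]⟩

theorem act_one_add_eq_self_iff {c : Zp2 p} {x : Disc ℂ_[p]} :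
    h.act (1 + c) x = x ↔ h.act c x = 0 := IsLubinTateBase.act_one_add_eq_self_iff

theorem IsTate.pow_act (he : h.IsTate e) (k n : ℕ) : h.act (p ^ k) (e (k + n)) = e n := by
  induction k with
  | zero => rw [pow_zero, act_one, zero_add]
  | succ k ih => rw [pow_succ, act_mul, add_right_comm, he.step, ih]

/-- `[u]` and `[v]` agree at `x` if and only if `[u - v]` vanishes at `x`. -/
theorem act_eq_act_iff {u v : Zp2 p} (hv : IsUnit v) {x : Disc ℂ_[p]} :
    h.act u x = h.act v x ↔ h.act (u - v) x = 0 := by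
  -- Multiplying by w = v⁻¹ turns u into 1 + w (u - v), the only kind of sum that can be treated
  -- without the full group law.
  obtain ⟨w, hw⟩ := hv.exists_left_inv
  have hwu : IsUnit w := IsUnit.of_mul_eq_one _ hw
  have h1 : w * u = 1 + w * (u - v) := by linear_combination hw
  rw [← (act_injective hwu).eq_iff, ← act_mul, ← act_mul, hw, act_one, h1,
    act_one_add_eq_self_iff, act_mul, act_eq_zero_iff hwu]

theorem IsTate.act_pow_mul_ne_zero (he : h.IsTate e) {k : ℕ} {c : Zp2 p} (hc : IsUnit c) :
    h.act (p ^ k * c) (e (k + 1)) ≠ 0 := by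
  rw [mul_comm, act_mul, he.pow_act, Ne, act_eq_zero_iff hc]
  exact he.one_ne_zero

theorem IsTate.act_congr (he : h.IsTate e) {n : ℕ} {u v : Zp2 p} (hv : IsUnit v)
    (huv : (p : Zp2 p) ^ n ∣ u - v) : h.act u (e n) = h.act v (e n) := by
  obtain ⟨c, hc⟩ := huv
  have := he.pow_act n 0
  rw [add_zero, he.zero] at this
  rw [act_eq_act_iff hv, hc, mul_comm, act_mul, this, act_zero]

/-- If u - v = p ^ k w with w a unit, then [u - v] sends e (k + 1) to [w](e 1), which is not zero.
-/
theorem IsTate.unique (he : h.IsTate e) {u v : Zp2 p} (hv : IsUnit v)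
    (huv : ∀ n, h.act u (e n) = h.act v (e n)) : u = v := by
  by_contra hne
  obtain ⟨k, w, hw, hk⟩ := h.exists_eq_pow_mul (sub_ne_zero.mpr hne)
  have h1 := (act_eq_act_iff hv).mp (huv (k + 1))
  rw [hk] at h1
  exact he.act_pow_mul_ne_zero hw h1

theorem coe_act_natCast (x : Disc ℂ_[p]) :
    (h.act p x : ℂ_[p]) = p * (x : ℂ_[p]) + (x : ℂ_[p]) ^ p ^ 2 :=
  IsLubinTateBase.coe_act_natCast x

/-- Both first terms satisfy x ^ (q - 1) = -p, so their ratio is a root of unity of `Z_{p²}`, which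
acts by ordinary multiplication. -/
theorem IsTate.exists_unit_one (he : h.IsTate e) (he' : h.IsTate e') :
    ∃ u : Zp2 p, IsUnit u ∧ h.act u (e 1) = e' 1 := by
  have h3 := three_le_sq_sub_one p
  have key {e : ℕ → Disc ℂ_[p]} (he : h.IsTate e) :
      (e 1 : ℂ_[p]) ≠ 0 ∧ (e 1 : ℂ_[p]) ^ (p ^ 2 - 1) = -p := by
    have h0 : (e 1 : ℂ_[p]) ≠ 0 := fun h0 => he.one_ne_zero (Subtype.ext h0)
    refine ⟨h0, mul_right_cancel₀ h0 ?_⟩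
    have h1 := congrArg Subtype.val (he.step 0)
    rw [he.zero, coe_act_natCast, Disc.coe_zero, zero_add] at h1
    rw [← pow_succ, show p ^ 2 - 1 + 1 = p ^ 2 by omega]
    linear_combination h1
  obtain ⟨h0, h1⟩ := key he
  obtain ⟨h0', h1'⟩ := key he'
  obtain ⟨ζ, hζ⟩ := exists_primitiveRoot_Zp2 (p := p)
  have hinj : Function.Injective (Zp2.toComplex p) :=
    (algebraMap (PadicAlgCl p) ℂ_[p]).injective.comp Zp2.toAlgClHom_injective
  have hζ' : IsPrimitiveRoot (Zp2.toComplex p ζ) (p ^ 2 - 1) := hζ.map_of_injective hinj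
  have : NeZero (p ^ 2 - 1) := ⟨by omega⟩
  obtain ⟨i, -, hi⟩ := hζ'.eq_pow_of_pow_eq_one
    (ξ := (e' 1 : ℂ_[p]) / e 1) (by
      rw [div_pow, h1, h1', div_self]
      rw [← h1]
      exact pow_ne_zero _ h0)
  have hpow : (ζ ^ i) ^ (p ^ 2 - 1) = 1 := by rw [← pow_mul, mul_comm, pow_mul, hζ.pow_eq_one, one_pow]
  refine ⟨ζ ^ i, IsUnit.of_pow_eq_one hpow (by omega), Subtype.ext ?_⟩
  rw [act, IsLubinTateBase.coe_act_of_pow_eq (pow_eq_of_pow_eq_one hpow), map_pow, hi,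
    div_mul_cancel₀ _ h0]

/-- The lifts u (1 + p ^ k t), for t Teichmüller, give q distinct roots of X ^ q + p X - e' k. The
point e' (k + 1) is also a root, and a polynomial of degree q has no room for another one. -/
theorem IsTate.exists_unit_succ (he : h.IsTate e) (he' : h.IsTate e') {k : ℕ} (hk : k ≠ 0)
    {u : Zp2 p} (hu : IsUnit u) (huk : h.act u (e k) = e' k) :
    ∃ v : Zp2 p, IsUnit v ∧ (p : Zp2 p) ^ k ∣ v - u ∧ h.act v (e (k + 1)) = e' (k + 1) := by
  classical
  obtain ⟨T, hTcard, hT, -⟩ := h.exists_teichmuller_finset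
  obtain ⟨k, rfl⟩ := Nat.exists_eq_succ_of_ne_zero hk
  let v (t : Zp2 p) : Zp2 p := u * (1 + p * (p ^ k * t))
  have hv (t : Zp2 p) : IsUnit (v t) := hu.mul (h.isUnit_one_add _)
  have hvu (t : Zp2 p) : (p : Zp2 p) ^ (k + 1) ∣ v t - u := ⟨u * t, by simp only [v]; ring⟩
  have hvk (t : Zp2 p) : h.act (v t) (e (k + 1)) = e' (k + 1) := by
    rw [he.act_congr hu (hvu t)]; exact huk
  by_contra! H
  let y (t : Zp2 p) : ℂ_[p] := h.act (v t) (e (k + 2))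
  have hyinj : Set.InjOn y T := by
    intro t ht t' ht' htt
    by_contra hne
    have h1 := (act_eq_act_iff (hv t')).mp (Subtype.ext htt)
    have h2 : v t - v t' = p ^ (k + 1) * (u * (t - t')) := by simp only [v]; ring
    rw [h2] at h1
    exact he.act_pow_mul_ne_zero (hu.mul (h.isUnit_sub_of_pow_eq (hT t ht) (hT t' ht') hne)) h1
  let P : Polynomial ℂ_[p] := Polynomial.X ^ p ^ 2 +
    (Polynomial.C (p : ℂ_[p]) * Polynomial.X - Polynomial.C (e' (k + 1) : ℂ_[p]))
  have h3 := three_le_sq_sub_one p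
  have hdeg : (Polynomial.C (p : ℂ_[p]) * Polynomial.X -
      Polynomial.C (e' (k + 1) : ℂ_[p])).degree <
      ((p ^ 2 : ℕ) : WithBot ℕ) := by
    refine (Polynomial.degree_sub_le _ _).trans_lt (max_lt ?_ ?_)
    · exact (Polynomial.degree_C_mul_X_le _).trans_lt (by exact_mod_cast (by omega))
    · exact Polynomial.degree_C_le.trans_lt (by exact_mod_cast (by omega))
  have hP : P.Monic := Polynomial.monic_X_pow_add hdeg
  have hPdeg : P.natDegree = p ^ 2 := by
    rw [Polynomial.natDegree_eq_of_degree_eq_some]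
    rw [Polynomial.degree_add_eq_left_of_degree_lt] <;> rw [Polynomial.degree_X_pow]
    exact hdeg
  have hroot {x : Disc ℂ_[p]} (hx : h.act p x = e' (k + 1)) : (x : ℂ_[p]) ∈ P.roots.toFinset := by
    rw [Multiset.mem_toFinset, Polynomial.mem_roots hP.ne_zero, Polynomial.IsRoot.def]
    have h1 := congrArg Subtype.val hx
    rw [coe_act_natCast] at h1
    simp only [P, Polynomial.eval_add, Polynomial.eval_sub, Polynomial.eval_mul, Polynomial.eval_C,
      Polynomial.eval_X, Polynomial.eval_pow]
    linear_combination h1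
  have hsub : insert (e' (k + 2) : ℂ_[p]) (T.image y) ⊆ P.roots.toFinset := by
    intro x hx
    rcases Finset.mem_insert.mp hx with rfl | hx
    · exact hroot (he'.step (k + 1))
    · obtain ⟨t, -, rfl⟩ := Finset.mem_image.mp hx
      refine hroot ?_
      rw [← act_mul, mul_comm, act_mul, he.step, hvk]
  have hcard := (Finset.card_le_card hsub).trans
    ((Multiset.toFinset_card_le _).trans (Polynomial.card_roots' P))
  rw [Finset.card_insert_of_notMem, Finset.card_image_of_injOn hyinj, hTcard, hPdeg] at hcard
  · omega
  · intro hmem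
    obtain ⟨t, -, ht⟩ := Finset.mem_image.mp hmem
    exact H (v t) (hv t) (hvu t) (Subtype.ext ht)

/-- The Tate module is free of rank one over `Z_{p²}`. -/
theorem IsTate.exists_unit (he : h.IsTate e) (he' : h.IsTate e') :
    ∃ u : Zp2 p, IsUnit u ∧ ∀ n, h.act u (e n) = e' n := by
  let S (k : ℕ) : Type := {u : Zp2 p // IsUnit u ∧ h.act u (e (k + 1)) = e' (k + 1)}
  choose next hn0 hn1 hn2 using fun (k : ℕ) (u : S k) =>
    he.exists_unit_succ he' (Nat.succ_ne_zero k) u.2.1 u.2.2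
  obtain ⟨u₁, hu₁, hu₁'⟩ := he.exists_unit_one he'
  let s : ∀ k, S k := fun k => Nat.rec ⟨u₁, hu₁, hu₁'⟩ (fun k u => ⟨next k u, hn0 k u, hn2 k u⟩) k
  have hs (k : ℕ) : (p : Zp2 p) ^ (k + 1) ∣ (s (k + 1)).1 - (s k).1 := hn1 k (s k)
  obtain ⟨L, hL⟩ := h.exists_limit (fun k => (s k).1)
    fun k => (pow_dvd_pow _ (Nat.le_succ k)).trans (hs k)
  have hact (n : ℕ) : h.act L (e n) = e' n := by
    -- The n-th unit matches the sequences at level n + 1, whereas L is only known to agree with it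
    -- modulo p ^ n; applying [p] descends to level n.
    rw [he.act_congr (s n).2.1 (hL n), ← he.step n, ← act_mul, mul_comm, act_mul, (s n).2.2,
      he'.step]
  -- If p divided L, then [L] would kill e 1, contradicting e' 1 ≠ 0.
  refine ⟨L, h.isUnit_of_not_dvd fun hd => ?_, hact⟩
  have h1 := he'.one_ne_zero
  obtain ⟨c, rfl⟩ := hd
  rw [← hact 1, mul_comm, act_mul, he.step 0, he.zero, act_zero] at h1
  exact h1 rfl

end IsSqrtGenerator

end TateModule

/-! ### The Galois action on torsion points: the projection π and the character χ₂. -/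

section LubinTateCharacters

variable {p : ℕ} [Fact p.Prime] {d : ℤ_[p]} {δ : Zp2 p}

theorem isLubinTateMul_iff {a : Zp2 p} {φ : PowerSeries (Zp2 p)} :
    IsLubinTateMul a φ ↔ IsLTEndo p (p ^ 2) a φ := by
  have h3 := three_le_sq_sub_one p
  have key (h0 : PowerSeries.constantCoeff φ = 0) :
      PowerSeries.subst φ (lubinTateSeries p) = PowerSeries.C (p : Zp2 p) * φ + φ ^ p ^ 2 := by
    have hs : PowerSeries.HasSubst φ := PowerSeries.HasSubst.of_constantCoeff_zero' h0
    rw [lubinTateSeries, PowerSeries.subst_add hs, PowerSeries.subst_mul hs,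
      PowerSeries.subst_pow hs, PowerSeries.subst_X hs, PowerSeries.subst_C]
    rfl
  constructor
  · intro h
    have h0 : PowerSeries.constantCoeff φ = 0 := by
      rw [← PowerSeries.coeff_zero_eq_constantCoeff_apply, h.coeff_zero]
    exact ⟨⟨h0, h.comm.trans (key h0)⟩, h.coeff_one⟩
  · intro h
    refine ⟨?_, h.coeff_one, ?_⟩
    · rw [PowerSeries.coeff_zero_eq_constantCoeff_apply, h.constantCoeff]
    · rw [key h.constantCoeff]
      exact h.commutes.2

/-- A point of norm less than `1` of the algebraic closure as a point of the unit disc. -/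
noncomputable def toDisc (x : PadicAlgCl p) (hx : ‖x‖ < 1) : Disc ℂ_[p] :=
  ⟨(x : ℂ_[p]), by rwa [PadicComplex.norm_extends]⟩

theorem coe_padicComplex_injective :
    Function.Injective ((↑) : PadicAlgCl p → ℂ_[p]) := (algebraMap (PadicAlgCl p) ℂ_[p]).injective

namespace IsSqrtGenerator

variable (h : IsSqrtGenerator p d δ)
include h

/-- A series in the algebraic closure converges to y there exactly when it converges to y in the
completion, where evaluation is always defined. -/
theorem lubinTateMulEq_iff {a : Zp2 p} {x y : PadicAlgCl p} (hx : ‖x‖ < 1) :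
    LubinTateMulEq a x y ↔ (h.act a (toDisc x hx) : ℂ_[p]) = (y : ℂ_[p]) := by
  have key {φ : PowerSeries (Zp2 p)} (hφ : IsLTEndo p (p ^ 2) a φ) :
      HasSum (fun k : ℕ => Zp2.toAlgCl p (PowerSeries.coeff k φ) * x ^ k) y ↔
        (h.act a (toDisc x hx) : ℂ_[p]) = (y : ℂ_[p]) := by
    rw [← hasSum_iff_hasSum_compl]
    have h1 := hasSum_evalHom h.norm_toComplex_le (toDisc x hx).2 φ
    rw [← IsLubinTateBase.coe_act (hR := h.isLubinTateBase) hφ] at h1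
    have h2 : (UniformSpace.Completion.toCompl (α := PadicAlgCl p)) ∘
        (fun k : ℕ => Zp2.toAlgCl p (PowerSeries.coeff k φ) * x ^ k) =
        fun k => Zp2.toComplex p (PowerSeries.coeff k φ) * (toDisc x hx : ℂ_[p]) ^ k := by
      funext k
      change ((Zp2.toAlgCl p (PowerSeries.coeff k φ) * x ^ k : PadicAlgCl p) : ℂ_[p]) = _
      rw [PadicComplex.coe_eq, map_mul, map_pow]
      rfl
    rw [h2]
    exact ⟨fun h3 => h1.unique h3, fun h3 => h3 ▸ h1⟩
  constructor
  · rintro ⟨φ, hφ, hs⟩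
    exact (key (isLubinTateMul_iff.mp hφ)).mp hs
  · intro he
    obtain ⟨φ, hφ⟩ := IsLTEndo.exists_endo h.isLubinTateBase a
    exact ⟨φ, isLubinTateMul_iff.mpr hφ, (key hφ).mpr he⟩

theorem lubinTateMulEq_iff_toDisc {a : Zp2 p} {x y : PadicAlgCl p} (hx : ‖x‖ < 1) (hy : ‖y‖ < 1) :
    LubinTateMulEq a x y ↔ h.act a (toDisc x hx) = toDisc y hy := by
  rw [h.lubinTateMulEq_iff hx, Subtype.ext_iff]
  rfl

end IsSqrtGenerator

theorem IsTateGenerator.norm_lt_one {e : ℕ → PadicAlgCl p} (he : IsTateGenerator e) (n : ℕ) :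
    ‖e n‖ < 1 := by
  induction n with
  | zero => rw [he.zero, norm_zero]; exact zero_lt_one
  | succ n ih => exact norm_lt_one_of_norm_lubinTate (by rwa [he.step])

theorem IsSqrtGenerator.act_natCast_toDisc (h : IsSqrtGenerator p d δ) {x y : PadicAlgCl p}
    (hx : ‖x‖ < 1) (hy : ‖y‖ < 1) :
    h.act p (toDisc x hx) = toDisc y hy ↔ (p : PadicAlgCl p) * x + x ^ (p ^ 2) = y := by
  rw [Subtype.ext_iff, IsSqrtGenerator.coe_act_natCast, ← coe_padicComplex_injective.eq_iff]
  have h1 : ((p * x + x ^ p ^ 2 : PadicAlgCl p) : ℂ_[p]) = p * (x : ℂ_[p]) + (x : ℂ_[p]) ^ p ^ 2 := by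
    rw [PadicComplex.coe_eq, map_add, map_mul, map_pow, map_natCast, ← PadicComplex.coe_eq]
  rw [h1]
  rfl

theorem IsTateGenerator.isTate (h : IsSqrtGenerator p d δ) {e : ℕ → PadicAlgCl p}
    (he : IsTateGenerator e) : h.IsTate fun n => toDisc (e n) (he.norm_lt_one n) where
  zero := Subtype.ext (congrArg ((↑) : PadicAlgCl p → ℂ_[p]) he.zero)
  one_ne_zero h0 := he.one_ne_zero (coe_padicComplex_injective (congrArg Subtype.val h0))
  step n := (h.act_natCast_toDisc _ _).mpr (he.step n)

/-- Two generators of the Tate module differ by a unit. -/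
theorem IsTateGenerator.exists_unit (h : IsSqrtGenerator p d δ) {e e' : ℕ → PadicAlgCl p}
    (he : IsTateGenerator e) (he' : IsTateGenerator e') :
    ∃ u : (Zp2 p)ˣ, ∀ n, LubinTateMulEq (u : Zp2 p) (e n) (e' n) := by
  obtain ⟨u, hu, hun⟩ := (he.isTate h).exists_unit (he'.isTate h)
  exact ⟨hu.unit, fun n => (h.lubinTateMulEq_iff_toDisc _ (he'.norm_lt_one n)).mpr (hun n)⟩

theorem IsTateGenerator.unit_unique (h : IsSqrtGenerator p d δ) {e e' : ℕ → PadicAlgCl p}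
    (he : IsTateGenerator e) {u v : (Zp2 p)ˣ}
    (hu : ∀ n, LubinTateMulEq (u : Zp2 p) (e n) (e' n))
    (hv : ∀ n, LubinTateMulEq (v : Zp2 p) (e n) (e' n)) : u = v := by
  apply Units.ext
  refine (he.isTate h).unique v.isUnit fun n => Subtype.ext ?_
  rw [(h.lubinTateMulEq_iff (he.norm_lt_one n)).mp (hu n),
    (h.lubinTateMulEq_iff (he.norm_lt_one n)).mp (hv n)]

theorem LubinTateMulEq.trans (h : IsSqrtGenerator p d δ) {a b : Zp2 p} {x y z : PadicAlgCl p}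
    (hx : ‖x‖ < 1) (hy : ‖y‖ < 1) (hxy : LubinTateMulEq a x y) (hyz : LubinTateMulEq b y z) :
    LubinTateMulEq (b * a) x z := by
  rw [h.lubinTateMulEq_iff_toDisc hx hy] at hxy
  rw [h.lubinTateMulEq_iff hy] at hyz
  rw [h.lubinTateMulEq_iff hx, IsSqrtGenerator.act_mul, hxy, hyz]

theorem norm_gal (g : GQp p) (x : PadicAlgCl p) : ‖g x‖ = ‖x‖ := by
  rw [← PadicAlgCl.spectralNorm_eq, ← PadicAlgCl.spectralNorm_eq]
  exact (spectralNorm_eq_of_equiv g x).symm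

theorem continuous_gal (g : GQp p) : Continuous g :=
  (AddMonoidHomClass.isometry_of_norm (g : PadicAlgCl p →+ PadicAlgCl p) (norm_gal g)).continuous

theorem IsTateGenerator.map_gal {e : ℕ → PadicAlgCl p} (he : IsTateGenerator e) (g : GQp p) :
    IsTateGenerator fun n => g (e n) where
  zero := by rw [he.zero, map_zero]
  one_ne_zero h0 := he.one_ne_zero ((map_eq_zero g).mp h0)
  step n := by rw [← he.step n, map_add, map_mul, map_pow, map_natCast]

/-- The action of `Gal(Q_{p²}/Q_p)` on `Z_{p²}`. -/
noncomputable def galHom (τ : Gal2 p) : Zp2 p →+* Zp2 p :=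
  ((τ.restrictScalars ℤ_[p]).mapIntegralClosure : Zp2 p ≃ₐ[ℤ_[p]] Zp2 p)

theorem coe_galAct (τ : Gal2 p) (z : (Zp2 p)ˣ) : (galAct p τ z : Zp2 p) = galHom τ z := rfl

/-- The automorphism g is an isometry, so it may be applied term by term; its effect on the
coefficients turns [a] into [τ a]. -/
theorem LubinTateMulEq.map_gal {a : Zp2 p} {x y : PadicAlgCl p} (hxy : LubinTateMulEq a x y)
    {g : GQp p} {τ : Gal2 p} (hτ : ∀ z : Qp2 p, ((τ z : Qp2 p) : PadicAlgCl p) = g z) :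
    LubinTateMulEq (galHom τ a) (g x) (g y) := by
  obtain ⟨φ, hφ, hs⟩ := hxy
  refine ⟨PowerSeries.map (galHom τ) φ, ?_, ?_⟩
  · rw [isLubinTateMul_iff] at hφ ⊢
    exact hφ.map (pow_ne_zero _ (Fact.out : p.Prime).ne_zero) _
  · convert hs.map g (continuous_gal g) using 1
    funext k
    rw [Function.comp_apply, map_mul, map_pow, PowerSeries.coeff_map]
    congr 1
    exact hτ _

instance Qp2.normal : Normal ℚ_[p] (Qp2 p) := by
  rw [IntermediateField.normal_iff_forall_map_le]
  intro σ
  rw [Qp2, IntermediateField.adjoin_map]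
  refine IntermediateField.adjoin.mono _ _ _ ?_
  rintro _ ⟨x, hx, rfl⟩
  rw [Set.mem_ofPred_eq] at hx ⊢
  rw [← map_pow, hx, map_one]

/-- Restriction of automorphisms to `Q_{p²}`. -/
noncomputable def resQp2 (p : ℕ) [Fact p.Prime] : GQp p →* Gal2 p :=
  AlgEquiv.restrictNormalHom (Qp2 p)

theorem coe_resQp2 (g : GQp p) (z : Qp2 p) :
    ((resQp2 p g z : Qp2 p) : PadicAlgCl p) = g z :=
  AlgEquiv.restrictNormal_commutes g (Qp2 p) z

theorem resQp2_eq_one (g : GQp2 p) : resQp2 p (g : GQp p) = 1 := by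
  ext z
  rw [coe_resQp2, AlgEquiv.one_apply]
  exact g.2 z

theorem eq_resQp2 {g : GQp p} {τ : Gal2 p}
    (hτ : ∀ z : Qp2 p, ((τ z : Qp2 p) : PadicAlgCl p) = g z) : τ = resQp2 p g := by
  ext z
  rw [hτ, coe_resQp2]

namespace IsSqrtGenerator

variable (h : IsSqrtGenerator p d δ) {e : ℕ → PadicAlgCl p}
include h

/-- The image of e under g is again a Tate generator, hence equals [u_g] e for a unique unit.
Applying g to k e = [u_k] e gives u_{gk} = u_g · g(u_k), the multiplication law of the semidirect
product. -/
theorem existsUnique_projection (he : IsTateGenerator e) :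
    ∃! π : GQp p →* Dihedral p, IsLubinTateProjection e π := by
  choose u hu using fun g : GQp p => he.exists_unit h (he.map_gal g)
  have huniq {π : GQp p → Dihedral p}
      (h1 : ∀ (g : GQp p) (z : Qp2 p), (((π g).right z : Qp2 p) : PadicAlgCl p) = g z)
      (h2 : ∀ (g : GQp p) (n : ℕ), LubinTateMulEq ((π g).left : Zp2 p) (e n) (g (e n)))
      (g : GQp p) : π g = ⟨u g, resQp2 p g⟩ :=
    SemidirectProduct.ext (he.unit_unique h (h2 g) (hu g)) (eq_resQp2 (h1 g))
  let π : GQp p →* Dihedral p := MonoidHom.mk' (fun g => ⟨u g, resQp2 p g⟩) (by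
    intro g k
    refine SemidirectProduct.ext ?_ (map_mul _ _ _)
    rw [SemidirectProduct.mul_left]
    refine he.unit_unique h (hu (g * k)) fun n => ?_
    have h1 := (hu k n).map_gal (coe_resQp2 g)
    rw [mul_comm]
    exact LubinTateMulEq.trans h (he.norm_lt_one n) ((he.map_gal g).norm_lt_one n) (hu g n) h1)
  refine ⟨π, ⟨coe_resQp2, hu⟩, fun π' hπ' => MonoidHom.ext fun g => ?_⟩
  exact huniq hπ'.right hπ'.left g

omit h in
theorem exists_lubinTate_eq (y : PadicAlgCl p) :
    ∃ x : PadicAlgCl p, (p : PadicAlgCl p) * x + x ^ (p ^ 2) = y := by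
  have h3 := three_le_sq_sub_one p
  let P : Polynomial (PadicAlgCl p) := Polynomial.X ^ p ^ 2 +
    (Polynomial.C (p : PadicAlgCl p) * Polynomial.X - Polynomial.C y)
  have hdeg : (Polynomial.C (p : PadicAlgCl p) * Polynomial.X - Polynomial.C y).degree <
      ((p ^ 2 : ℕ) : WithBot ℕ) := by
    refine (Polynomial.degree_sub_le _ _).trans_lt (max_lt ?_ ?_)
    · exact (Polynomial.degree_C_mul_X_le _).trans_lt (by exact_mod_cast (by omega))
    · exact Polynomial.degree_C_le.trans_lt (by exact_mod_cast (by omega))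
  obtain ⟨x, hx⟩ := IsAlgClosed.exists_root P (by
    rw [Polynomial.degree_add_eq_left_of_degree_lt] <;> rw [Polynomial.degree_X_pow]
    · exact_mod_cast (by omega)
    · exact hdeg)
  refine ⟨x, ?_⟩
  rw [Polynomial.IsRoot.def] at hx
  simp only [P, Polynomial.eval_add, Polynomial.eval_sub, Polynomial.eval_mul, Polynomial.eval_C,
    Polynomial.eval_X, Polynomial.eval_pow] at hx
  linear_combination hx

omit h in
/-- A nonzero torsion point is a member of a generator of the Tate module. -/
theorem exists_isTateGenerator_eq {x : PadicAlgCl p} (hx : IsLubinTateTorsion x) (h0 : x ≠ 0) :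
    ∃ (e : ℕ → PadicAlgCl p) (n : ℕ), IsTateGenerator e ∧ e n = x := by
  classical
  set f : PadicAlgCl p → PadicAlgCl p := fun t => (p : PadicAlgCl p) * t + t ^ (p ^ 2) with hf
  have hx' : ∃ n, f^[n] x = 0 := hx
  obtain ⟨n, hn⟩ : ∃ n, Nat.find hx' = n + 1 := by
    refine Nat.exists_eq_succ_of_ne_zero fun hz => h0 ?_
    have := Nat.find_spec hx'
    rwa [hz] at this
  choose r hr using exists_lubinTate_eq (p := p)
  -- Place x at index n + 1, its exact order: iterates of [p] fill the lower indices and chosen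
  -- preimages the higher ones. Minimality of n + 1 gives e 1 ≠ 0.
  let e (j : ℕ) : PadicAlgCl p := if j ≤ n + 1 then f^[n + 1 - j] x else r^[j - (n + 1)] x
  refine ⟨e, n + 1, ⟨?_, ?_, fun j => ?_⟩, by simp [e]⟩
  · have := Nat.find_spec hx'
    rw [hn] at this
    simpa [e] using this
  · have := Nat.find_min hx' (m := n) (by omega)
    simpa [e] using this
  · change f (e (j + 1)) = e j
    rcases lt_trichotomy j (n + 1) with h1 | h1 | h1
    · simp only [e, if_pos h1.le, if_pos (Nat.succ_le_of_lt h1)]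
      rw [← Function.iterate_succ_apply' f]
      congr 2
      omega
    · subst h1
      simp only [e, le_refl, if_true, tsub_self, Function.iterate_zero, id]
      rw [if_neg (by omega), show n + 1 + 1 - (n + 1) = 1 by omega, Function.iterate_one]
      exact hr x
    · simp only [e]
      rw [if_neg (by omega), if_neg (by omega), show j + 1 - (n + 1) = (j - (n + 1)) + 1 by omega,
        Function.iterate_succ_apply']
      exact hr _

omit h in
theorem _root_.IsTateGenerator.isLubinTateTorsion (he : IsTateGenerator e) (n : ℕ) :
    IsLubinTateTorsion (e n) := by
  refine ⟨n, ?_⟩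
  induction n with
  | zero => exact he.zero
  | succ n ih => rw [Function.iterate_succ_apply, he.step, ih]

/-- A nonzero torsion point is [u](e n) for some unit u. As g fixes `Z_{p²}`, its action commutes
with [u], so a formula valid on e is valid everywhere. -/
theorem lubinTateMulEq_of_torsion (he : IsTateGenerator e) {g : GQp2 p} {a : Zp2 p}
    (hg : ∀ n, LubinTateMulEq a (e n) ((g : GQp p) (e n))) {x : PadicAlgCl p}
    (hx : IsLubinTateTorsion x) : LubinTateMulEq a x ((g : GQp p) x) := by
  by_cases h0 : x = 0
  · subst h0
    have h1 := hg 0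
    rwa [he.zero] at h1
  obtain ⟨e', n, he', rfl⟩ := exists_isTateGenerator_eq hx h0
  obtain ⟨u, hu⟩ := he.exists_unit h he'
  have h1 := (hu n).map_gal (coe_resQp2 (g : GQp p))
  rw [resQp2_eq_one, show galHom (1 : Gal2 p) (u : Zp2 p) = u from rfl] at h1
  have h2 := LubinTateMulEq.trans h (he.norm_lt_one n) ((he.map_gal g).norm_lt_one n) (hg n) h1
  have h3 := hu n
  rw [h.lubinTateMulEq_iff_toDisc (he.norm_lt_one n) (he'.norm_lt_one n)] at h3
  rw [h.lubinTateMulEq_iff (he.norm_lt_one n), mul_comm, act_mul, h3] at h2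
  rw [h.lubinTateMulEq_iff (he'.norm_lt_one n)]
  exact h2

theorem existsUnique_character (he : IsTateGenerator e) :
    ∃! χ : GQp2 p →* (Zp2 p)ˣ, IsLubinTateCharacter χ := by
  obtain ⟨π, hπ, -⟩ := h.existsUnique_projection he
  have hr (g : GQp2 p) : (π g).right = 1 := (eq_resQp2 (hπ.right g)).trans (resQp2_eq_one g)
  let χ : GQp2 p →* (Zp2 p)ˣ := MonoidHom.mk' (fun g => (π g).left) (by
    intro g k
    rw [Subgroup.coe_mul, map_mul, SemidirectProduct.mul_left, hr, map_one, MulAut.one_apply])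
  refine ⟨χ, fun g x hx => h.lubinTateMulEq_of_torsion he (hπ.left g) hx, fun χ' hχ' => ?_⟩
  ext1 g
  exact he.unit_unique h (fun n => hχ' g (e n) (he.isLubinTateTorsion n)) (hπ.left g)

theorem projection_left_eq (he : IsTateGenerator e) {π : GQp p →* Dihedral p}
    (hπ : IsLubinTateProjection e π) {χ : GQp2 p →* (Zp2 p)ˣ} (hχ : IsLubinTateCharacter χ)
    (g : GQp2 p) : π g = ⟨χ g, 1⟩ :=
  SemidirectProduct.ext
    (he.unit_unique h (hπ.left g) fun n => hχ g (e n) (he.isLubinTateTorsion n))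
    ((eq_resQp2 (hπ.right g)).trans (resQp2_eq_one g))

end IsSqrtGenerator

end LubinTateCharacters

/-! ### The characters η and the binomial series. -/

section Eta

variable {p : ℕ} [Fact p.Prime] {d : ℤ_[p]} {δ : Zp2 p}

instance Zp2.continuousMul : ContinuousMul (Zp2 p) :=
  inferInstanceAs (ContinuousMul (Zp2 p).toSubsemiring)

instance Zp2.continuousAdd : ContinuousAdd (Zp2 p) :=
  inferInstanceAs (ContinuousAdd (Zp2 p).toSubsemiring)

theorem continuous_algebraMap_Zp2 : Continuous (algebraMap ℤ_[p] (Zp2 p)) := by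
  refine continuous_induced_rng.mpr (continuous_induced_rng.mpr ?_)
  exact (continuous_algebraMap ℚ_[p] (PadicAlgCl p)).comp continuous_subtype_val

/-- Any extension of τ to the algebraic closure is an isometry. -/
theorem continuous_galHom (τ : Gal2 p) : Continuous (galHom τ) := by
  obtain ⟨g, hg⟩ := AlgEquiv.restrictNormalHom_surjective (F := ℚ_[p]) (K₁ := Qp2 p)
    (PadicAlgCl p) τ
  refine continuous_induced_rng.mpr (continuous_induced_rng.mpr ?_)
  have h1 : (Subtype.val ∘ Subtype.val ∘ galHom τ : Zp2 p → PadicAlgCl p) =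
      g ∘ (fun z : Zp2 p => ((z : Qp2 p) : PadicAlgCl p)) := by
    funext z
    change ((τ (z : Qp2 p) : Qp2 p) : PadicAlgCl p) = g z
    rw [← hg]
    exact coe_resQp2 g z
  rw [h1]
  exact (continuous_gal g).comp (continuous_subtype_val.comp continuous_subtype_val)

theorem galHom_algebraMap (τ : Gal2 p) (c : ℤ_[p]) :
    galHom τ (algebraMap ℤ_[p] (Zp2 p) c) = algebraMap ℤ_[p] (Zp2 p) c :=
  AlgEquiv.commutes (τ.restrictScalars ℤ_[p]).mapIntegralClosure c

/-- The binomial series `y ^ s = ∑ k, (s choose k) (y - 1) ^ k`. -/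
noncomputable def binPow (s : ℤ_[p]) (y : Zp2 p) : Zp2 p :=
  ∑' k : ℕ, algebraMap ℤ_[p] (Zp2 p) (Ring.choose s k) * (y - 1) ^ k

theorem binPow_natCast (n : ℕ) (y : Zp2 p) : binPow (n : ℤ_[p]) y = y ^ n := by
  have h1 (k : ℕ) : Ring.choose (n : ℤ_[p]) k = (n.choose k : ℤ_[p]) := Ring.choose_natCast n k
  rw [binPow, tsum_eq_sum (s := Finset.range (n + 1))]
  · conv_rhs => rw [← sub_add_cancel y 1, add_pow]
    refine Finset.sum_congr rfl fun k _ => ?_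
    rw [h1, map_natCast, one_pow, mul_one, mul_comm]
  · intro k hk
    rw [Finset.mem_range, not_lt] at hk
    rw [h1, Nat.choose_eq_zero_of_lt hk, Nat.cast_zero, map_zero, zero_mul]

theorem binPow_one (s : ℤ_[p]) : binPow s 1 = 1 := by
  rw [binPow, tsum_eq_single 0]
  · simp
  · intro k hk
    rw [sub_self, zero_pow hk, mul_zero]

theorem galHom_natCast_dvd (τ : Gal2 p) {y : Zp2 p} (hy : (p : Zp2 p) ∣ y - 1) :
    (p : Zp2 p) ∣ galHom τ y - 1 := by
  have := map_dvd (galHom τ) hy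
  rwa [map_natCast, map_sub, map_one] at this

theorem dvd_mul_sub_one {y y' : Zp2 p} (hy : (p : Zp2 p) ∣ y - 1) (hy' : (p : Zp2 p) ∣ y' - 1) :
    (p : Zp2 p) ∣ y * y' - 1 := by
  have h1 := dvd_add (hy.mul_right y') hy'
  convert h1 using 1
  ring

theorem IsOmegaDiam.mul {x w y x' w' y' : (Zp2 p)ˣ} (h : IsOmegaDiam x w y)
    (h' : IsOmegaDiam x' w' y') : IsOmegaDiam (x * x') (w * w') (y * y') := by
  refine ⟨?_, ?_, dvd_mul_sub_one h.2.2 h'.2.2⟩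
  · rw [h.1, h'.1, mul_mul_mul_comm]
  · rw [mul_pow, h.2.1, h'.2.1, one_mul]

theorem IsOmegaDiam.galAct {x w y : (Zp2 p)ˣ} (h : IsOmegaDiam x w y) (τ : Gal2 p) :
    IsOmegaDiam (galAct p τ x) (galAct p τ w) (galAct p τ y) := by
  refine ⟨?_, ?_, galHom_natCast_dvd τ h.2.2⟩
  · rw [h.1, map_mul]
  · rw [← map_pow, h.2.1, map_one]

namespace IsSqrtGenerator

variable (h : IsSqrtGenerator p d δ)
include h

/-- With y - 1 = p z, both coordinates of the k-th term have norm at most ‖p‖ ^ k, uniformly in s.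
The sums thus converge in `Z_p`, and their continuity in s follows from that of the binomial
coefficients. -/
theorem exists_hasSum_binPow {y : Zp2 p} (hy : (p : Zp2 p) ∣ y - 1) :
    ∃ E : ℤ_[p] → Zp2 p, Continuous E ∧ ∀ s, HasSum
      (fun k : ℕ => algebraMap ℤ_[p] (Zp2 p) (Ring.choose s k) * (y - 1) ^ k) (E s) := by
  obtain ⟨z, hz⟩ := hy
  have hpnorm : ‖(p : ℤ_[p])‖ < 1 := PadicInt.p_nonunit |> PadicInt.mem_nonunits.mp
  have key (a : ℕ → ℤ_[p]) : ∃ A : ℤ_[p] → ℤ_[p], Continuous A ∧ ∀ s,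
      HasSum (fun k : ℕ => Ring.choose s k * (p ^ k * a k)) (A s) := by
    have hb (k : ℕ) (s : ℤ_[p]) : ‖Ring.choose s k * (p ^ k * a k)‖ ≤ ‖(p : ℤ_[p])‖ ^ k := by
      rw [norm_mul, norm_mul, norm_pow]
      calc _ ≤ 1 * (‖(p : ℤ_[p])‖ ^ k * 1) := by
            gcongr <;> exact PadicInt.norm_le_one _
        _ = _ := by rw [mul_one, one_mul]
    have hg := summable_geometric_of_lt_one (norm_nonneg _) hpnorm
    refine ⟨fun s => ∑' k : ℕ, Ring.choose s k * (p ^ k * a k), ?_, fun s => ?_⟩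
    · exact continuous_tsum (fun k => (PadicInt.continuous_choose k).mul continuous_const) hg hb
    · exact (Summable.of_norm_bounded hg fun k => hb k s).hasSum
  obtain ⟨A, hA, hAs⟩ := key fun k => h.basis.repr (z ^ k) 0
  obtain ⟨B, hB, hBs⟩ := key fun k => h.basis.repr (z ^ k) 1
  refine ⟨fun s => algebraMap ℤ_[p] (Zp2 p) (A s) + algebraMap ℤ_[p] (Zp2 p) (B s) * δ, ?_,
    fun s => ?_⟩
  · exact (continuous_algebraMap_Zp2.comp hA).add
      ((continuous_algebraMap_Zp2.comp hB).mul continuous_const)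
  · have h1 := ((hAs s).map (algebraMap ℤ_[p] (Zp2 p)) continuous_algebraMap_Zp2).add
      (((hBs s).map (algebraMap ℤ_[p] (Zp2 p)) continuous_algebraMap_Zp2).map
        (AddMonoidHom.mulRight δ) (continuous_id.mul continuous_const))
    convert! h1 using 1
    funext k
    simp only [Function.comp_apply, AddMonoidHom.coe_mulRight, map_mul, map_pow, map_natCast]
    rw [hz, mul_pow, h.eq_coord (z ^ k)]
    simp only [(h.repr_eq _ _).1, (h.repr_eq _ _).2]
    ring

theorem hasSum_binPow {y : Zp2 p} (hy : (p : Zp2 p) ∣ y - 1) (s : ℤ_[p]) :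
    HasSum (fun k : ℕ => algebraMap ℤ_[p] (Zp2 p) (Ring.choose s k) * (y - 1) ^ k) (binPow s y) :=
  let ⟨_, _, hE⟩ := h.exists_hasSum_binPow hy
  (hE s).summable.hasSum

theorem continuous_binPow {y : Zp2 p} (hy : (p : Zp2 p) ∣ y - 1) :
    Continuous fun s => binPow s y := by
  obtain ⟨E, hE, hs⟩ := h.exists_hasSum_binPow hy
  have : (fun s => binPow s y) = E := funext fun s => (h.hasSum_binPow hy s).unique (hs s)
  rwa [this]

/-- Both sides are continuous in s and agree for natural s, which are dense in `Z_p`. -/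
theorem binPow_mul {y y' : Zp2 p} (hy : (p : Zp2 p) ∣ y - 1) (hy' : (p : Zp2 p) ∣ y' - 1)
    (s : ℤ_[p]) : binPow s (y * y') = binPow s y * binPow s y' := by
  have h1 := PadicInt.denseRange_natCast (p := p) |>.equalizer
    (h.continuous_binPow (dvd_mul_sub_one hy hy'))
    ((h.continuous_binPow hy).mul (h.continuous_binPow hy')) (by
      funext n
      simp only [Function.comp_apply, binPow_natCast, Pi.mul_apply, mul_pow])
  exact congrFun h1 s

theorem isUnit_binPow {y : (Zp2 p)ˣ} (hy : (p : Zp2 p) ∣ (y : Zp2 p) - 1) (s : ℤ_[p]) :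
    IsUnit (binPow s (y : Zp2 p)) := by
  have hy' : (p : Zp2 p) ∣ ((y⁻¹ : (Zp2 p)ˣ) : Zp2 p) - 1 := by
    have h1 : ((y⁻¹ : (Zp2 p)ˣ) : Zp2 p) * y = 1 := y.inv_mul
    have h2 := hy.mul_left (-((y⁻¹ : (Zp2 p)ˣ) : Zp2 p))
    convert h2 using 1
    linear_combination h1
  refine IsUnit.of_mul_eq_one (binPow s ((y⁻¹ : (Zp2 p)ˣ) : Zp2 p)) ?_
  rw [← h.binPow_mul hy hy', Units.mul_inv, binPow_one]

theorem isEta_apply {r : ZMod (p ^ 2 - 1)} {s : ℤ_[p]} {η : (Zp2 p)ˣ →* (Zp2 p)ˣ}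
    (hη : IsEta r s η) {x w y : (Zp2 p)ˣ} (hx : IsOmegaDiam x w y) :
    (η x : Zp2 p) = (w : Zp2 p) ^ r.val * binPow s (y : Zp2 p) := by
  obtain ⟨t, ht, hs⟩ := hη x w y hx
  rw [ht, Units.val_mul, Units.val_pow_eq_pow_val, hs.unique (h.hasSum_binPow hx.2.2 s)]

theorem existsUnique_isEta (r : ZMod (p ^ 2 - 1)) (s : ℤ_[p]) :
    ∃! η : (Zp2 p)ˣ →* (Zp2 p)ˣ, IsEta r s η := by
  choose w y hwy using h.exists_isOmegaDiam
  let t (x : (Zp2 p)ˣ) : (Zp2 p)ˣ := (h.isUnit_binPow (hwy x).2.2 s).unit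
  have ht (x : (Zp2 p)ˣ) : (t x : Zp2 p) = binPow s (y x : Zp2 p) := IsUnit.unit_spec _
  let η : (Zp2 p)ˣ →* (Zp2 p)ˣ := MonoidHom.mk' (fun x => w x ^ r.val * t x) (by
    intro a b
    obtain ⟨h1, h2⟩ := h.isOmegaDiam_unique (hwy (a * b)) ((hwy a).mul (hwy b))
    have h3 : t (a * b) = t a * t b := by
      apply Units.ext
      rw [Units.val_mul, ht, ht, ht, h2, Units.val_mul, h.binPow_mul (hwy a).2.2 (hwy b).2.2]
    rw [h1, h3, mul_pow, mul_mul_mul_comm])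
  refine ⟨η, fun x w' y' hx => ?_, fun η' hη' => ?_⟩
  · obtain ⟨rfl, rfl⟩ := h.isOmegaDiam_unique hx (hwy x)
    refine ⟨t x, rfl, ?_⟩
    rw [ht]
    exact h.hasSum_binPow hx.2.2 s
  · ext1 x
    apply Units.ext
    rw [h.isEta_apply hη' (hwy x)]
    change _ = ((w x ^ r.val * t x : (Zp2 p)ˣ) : Zp2 p)
    rw [Units.val_mul, ht, Units.val_pow_eq_pow_val]

theorem galHom_binPow (τ : Gal2 p) {y : Zp2 p} (hy : (p : Zp2 p) ∣ y - 1) (s : ℤ_[p]) :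
    galHom τ (binPow s y) = binPow s (galHom τ y) := by
  have h1 := (h.hasSum_binPow hy s).map (galHom τ) (continuous_galHom τ)
  refine HasSum.unique ?_ (h.hasSum_binPow (galHom_natCast_dvd τ hy) s)
  convert h1 using 1
  funext k
  rw [Function.comp_apply, map_mul, map_pow, map_sub, map_one, galHom_algebraMap]

theorem isEta_galAct {r : ZMod (p ^ 2 - 1)} {s : ℤ_[p]} {η : (Zp2 p)ˣ →* (Zp2 p)ˣ}
    (hη : IsEta r s η) (τ : Gal2 p) (z : (Zp2 p)ˣ) :
    η (galAct p τ z) = galAct p τ (η z) := by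
  obtain ⟨w, y, hz⟩ := h.exists_isOmegaDiam z
  apply Units.ext
  rw [h.isEta_apply hη (hz.galAct τ), coe_galAct, coe_galAct, coe_galAct, h.isEta_apply hη hz,
    map_mul, map_pow, h.galHom_binPow τ hz.2.2]

end IsSqrtGenerator

end Eta

/-! ### Recognizing a representation induced from a subgroup of index two. -/

section Induced

open Representation

variable {k G W : Type*} [CommRing k] [Group G] [AddCommGroup W] [Module k W] {H : Subgroup G}
  (ρ : Representation k H k) (σ : Representation k G W)

/-- The map from an induced representation given by Frobenius reciprocity. -/
noncomputable def indLift (f : k →ₗ[k] W) (hf : ∀ (h : H) (a : k), σ h (f a) = f (ρ h a)) :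
    IndV H.subtype ρ →ₗ[k] W :=
  Coinvariants.lift _
    (TensorProduct.lift <| (Finsupp.lift _ _ _ fun h => σ h⁻¹ ∘ₗ f) ∘ₗ
      (MonoidAlgebra.coeffLinearEquiv k).toLinearMap)
    fun g => by
      ext h
      have h1 := hf g (ρ g⁻¹ 1)
      simp [mul_inv_rev, ← hf g 1, ← Module.End.mul_apply, ← map_mul]

/-- The inverse reflects the conventions for `IndV`: H acts on the left of the group variable, and g
in G acts by right translation by g⁻¹. -/
theorem indLift_mk (f : k →ₗ[k] W) (hf : ∀ (h : H) (a : k), σ h (f a) = f (ρ h a)) (g : G) (a : k) :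
    indLift ρ σ f hf (IndV.mk H.subtype ρ g a) = σ g⁻¹ (f a) := by
  simp [indLift]

theorem indV_mk_mul (h : H) (g : G) (a : k) :
    IndV.mk H.subtype ρ (h * g) (ρ h a) = IndV.mk H.subtype ρ g a := by
  have := Coinvariants.mk_self_apply (tprod ((leftRegular k G).comp H.subtype) ρ) h
    (MonoidAlgebra.single g (1 : k) ⊗ₜ[k] a)
  simpa using this

/-- The group is covered by H and H g₀, and the factor from H can be absorbed into the scalar. -/
theorem span_indV_mk {g₀ : G} (hg₀ : ∀ g, g ∉ H → g * g₀⁻¹ ∈ H) (x : IndV H.subtype ρ) :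
    ∃ a b : k, x = a • IndV.mk H.subtype ρ 1 1 + b • IndV.mk H.subtype ρ g₀ 1 := by
  obtain ⟨y, rfl⟩ := Coinvariants.mk_surjective _ x
  have add' {x y : IndV H.subtype ρ}
      (hx : ∃ a b : k, x = a • IndV.mk H.subtype ρ 1 1 + b • IndV.mk H.subtype ρ g₀ 1)
      (hy : ∃ a b : k, y = a • IndV.mk H.subtype ρ 1 1 + b • IndV.mk H.subtype ρ g₀ 1) :
      ∃ a b : k, x + y = a • IndV.mk H.subtype ρ 1 1 + b • IndV.mk H.subtype ρ g₀ 1 := by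
    obtain ⟨a, b, rfl⟩ := hx
    obtain ⟨a', b', rfl⟩ := hy
    exact ⟨a + a', b + b', by module⟩
  induction y using TensorProduct.induction_on with
  | zero => exact ⟨0, 0, by simp⟩
  | add x y hx hy => rw [map_add]; exact add' hx hy
  | tmul m c =>
    induction m using MonoidAlgebra.induction_linear with
    | zero => exact ⟨0, 0, by simp⟩
    | add f g hf hg => rw [TensorProduct.add_tmul, map_add]; exact add' hf hg
    | single g r =>
      have h1 : Coinvariants.mk (tprod ((leftRegular k G).comp H.subtype) ρ)
          (MonoidAlgebra.single g r ⊗ₜ[k] c) = r • IndV.mk H.subtype ρ g c := by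
        have h2 : (MonoidAlgebra.single g r : MonoidAlgebra k G) = r • MonoidAlgebra.single g 1 := by
          simp
        rw [h2, ← TensorProduct.smul_tmul', map_smul]
        rfl
      have key (h : H) (g : G) (a : k) : IndV.mk H.subtype ρ (h * g) a =
          (ρ h⁻¹ a) • IndV.mk H.subtype ρ g 1 := by
        have h2 : ρ h (ρ h⁻¹ a) = a := by
          rw [← Module.End.mul_apply, ← map_mul, mul_inv_cancel, map_one, Module.End.one_apply]
        conv_lhs => rw [← h2]
        rw [indV_mk_mul, ← map_smul, smul_eq_mul, mul_one]
      rw [h1]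
      by_cases hg : g ∈ H
      · have h2 := key ⟨g, hg⟩ 1 c
        rw [mul_one] at h2
        exact ⟨r * ρ ⟨g, hg⟩⁻¹ c, 0, by rw [h2, smul_smul, zero_smul, add_zero]⟩
      · have h2 := key ⟨_, hg₀ g hg⟩ g₀ c
        rw [inv_mul_cancel_right] at h2
        exact ⟨0, r * ρ ⟨_, hg₀ g hg⟩⁻¹ c, by rw [h2, smul_smul, zero_smul, zero_add]⟩

/-- A representation of `G` with a basis `v, g₀⁻¹ v`, where `v` is an eigenvector for a subgroup
of index two, is induced from this subgroup. -/
theorem nonempty_equiv_ind {v : W} (hv : ∀ h : H, σ h v = ρ h 1 • v) {g₀ : G}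
    (hg₀ : ∀ g, g ∉ H → g * g₀⁻¹ ∈ H)
    (hli : ∀ a b : k, a • v + b • σ g₀⁻¹ v = 0 → a = 0 ∧ b = 0)
    (hspan : ∀ w : W, ∃ a b : k, w = a • v + b • σ g₀⁻¹ v) :
    Nonempty (σ.Equiv (ind H.subtype ρ)) := by
  have hf (h : H) (a : k) : σ h (LinearMap.toSpanSingleton k W v a) =
      LinearMap.toSpanSingleton k W v (ρ h a) := by
    have h1 : ρ h a = a * ρ h 1 := by
      rw [← smul_eq_mul, ← map_smul, smul_eq_mul, mul_one]
    rw [LinearMap.toSpanSingleton_apply, LinearMap.toSpanSingleton_apply, map_smul, hv, h1,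
      smul_smul]
  set F := indLift ρ σ (LinearMap.toSpanSingleton k W v) hf with hF
  have hFmk (g : G) (a : k) : F (IndV.mk H.subtype ρ g a) = a • σ g⁻¹ v := by
    rw [hF, indLift_mk, LinearMap.toSpanSingleton_apply, map_smul]
  have hF2 (a b : k) : F (a • IndV.mk H.subtype ρ 1 1 + b • IndV.mk H.subtype ρ g₀ 1) =
      a • v + b • σ g₀⁻¹ v := by
    rw [map_add, map_smul, map_smul, hFmk, hFmk, one_smul, one_smul, inv_one, map_one,
      Module.End.one_apply]
  -- F sends the two spanning vectors of the induced module to a basis of W; hence they are a basis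
  -- too, with no separate dimension count.
  have hbij : Function.Bijective F := by
    constructor
    · rw [← LinearMap.ker_eq_bot, LinearMap.ker_eq_bot']
      intro x hx
      obtain ⟨a, b, rfl⟩ := span_indV_mk ρ hg₀ x
      rw [hF2] at hx
      obtain ⟨rfl, rfl⟩ := hli a b hx
      rw [zero_smul, zero_smul, add_zero]
    · intro w
      obtain ⟨a, b, rfl⟩ := hspan w
      exact ⟨_, hF2 a b⟩
  have hcomm (g : G) : (LinearEquiv.ofBijective F hbij : _ →ₗ[k] _) ∘ₗ ind H.subtype ρ g =
      σ g ∘ₗ (LinearEquiv.ofBijective F hbij : _ →ₗ[k] _) := by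
    apply IndV.hom_ext
    intro x
    ext
    change F (ind H.subtype ρ g (IndV.mk H.subtype ρ x 1)) = σ g (F (IndV.mk H.subtype ρ x 1))
    rw [ind_mk, hFmk, hFmk, mul_inv_rev, inv_inv, one_smul, one_smul, map_mul,
      Module.End.mul_apply]
  exact ⟨(Representation.Equiv.mk (LinearEquiv.ofBijective F hbij) hcomm).symm⟩

end Induced

/-! ### Eigenvectors of the base change and the final isomorphism. -/

section Comparison

variable {p : ℕ} [Fact p.Prime] {d : ℤ_[p]} {δ : Zp2 p}

theorem galSign_eq_one_or (τ : Gal2 p) : galSign τ = 1 ∨ galSign τ = -1 := by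
  unfold galSign; split_ifs <;> simp

theorem galSign_eq_one_iff {τ : Gal2 p} : galSign τ = 1 ↔ τ = 1 := by
  unfold galSign
  split_ifs with h
  · simp [h]
  · simp only [h, iff_false]
    intro h1
    have h2 : ((-1 : ℤ) : ℤ_[p]) = ((1 : ℤ) : ℤ_[p]) := by exact_mod_cast h1
    have := Int.cast_injective h2
    omega

theorem mem_GQp2_iff {g : GQp p} : g ∈ GQp2 p ↔ resQp2 p g = 1 := by
  refine ⟨fun h => resQp2_eq_one ⟨g, h⟩, fun h z => ?_⟩
  have := coe_resQp2 g z
  rw [h] at this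
  exact this.symm

namespace IsSqrtGenerator

variable (h : IsSqrtGenerator p d δ)
include h

theorem ne_zero : δ ≠ 0 := by
  intro h0
  have := (h.coord_zero (x := 0) (y := 1) (by rw [h0]; simp)).2
  exact one_ne_zero this

/-- Some element of the Galois group acts nontrivially on `Q_{p²}`. -/
theorem exists_notMem_GQp2 : ∃ g : GQp p, g ∉ GQp2 p := by
  by_contra! H
  -- Otherwise √d is fixed by the whole Galois group, so it lies in `Q_p`, and in `Z_p` by its norm,
  -- against the independence of 1 and √d.
  have hfix (g : GQp p) : g (Zp2.toAlgCl p δ) = Zp2.toAlgCl p δ := H g (δ : Qp2 p)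
  have h1 : Zp2.toAlgCl p δ ∈ (⊥ : IntermediateField ℚ_[p] (PadicAlgCl p)) := by
    rw [InfiniteGalois.mem_bot_iff_fixed]
    exact hfix
  obtain ⟨c, hc⟩ := IntermediateField.mem_bot.mp h1
  have hcn : ‖c‖ ≤ 1 := by
    rw [← PadicAlgCl.norm_extends p c, hc]
    exact h.norm_le_one δ
  have h2 : algebraMap ℤ_[p] (Zp2 p) ⟨c, hcn⟩ = δ := Zp2.toAlgClHom_injective hc
  have := (h.coord_zero (x := ⟨c, hcn⟩) (y := -1) (by rw [h2]; simp)).2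
  exact one_ne_zero (neg_eq_zero.mp this)

theorem mul_inv_mem {g g₀ : GQp p} (hg : g ∉ GQp2 p) (hg₀ : g₀ ∉ GQp2 p) : g * g₀⁻¹ ∈ GQp2 p := by
  have key {g : GQp p} (hg : g ∉ GQp2 p) : galSign (resQp2 p g) = -1 := by
    rw [mem_GQp2_iff, ← galSign_eq_one_iff] at hg
    exact (galSign_eq_one_or _).resolve_left hg
  have hinv : g₀⁻¹ ∉ GQp2 p := fun hm => hg₀ (by simpa using inv_mem hm)
  rw [mem_GQp2_iff, ← galSign_eq_one_iff, map_mul, h.galSign_mul, key hg, key hinv, neg_one_mul,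
    neg_neg]

/-- The basis of `Q_{p²} ⊗ V` coming from the canonical basis of `Z_p²`. -/
noncomputable def _root_.tensorBasis (p : ℕ) [Fact p.Prime] :
    Module.Basis (Fin 2) (Qp2 p) (Qp2 p ⊗[ℚ_[p]] (ℚ_[p] ⊗[ℤ_[p]] (Fin 2 → ℤ_[p]))) :=
  ((Pi.basisFun ℤ_[p] (Fin 2)).baseChange ℚ_[p]).baseChange (Qp2 p)

omit h in
theorem _root_.extendScalars_tensorBasis {G : Type*} [Group G] (ρ : G →* GL (Fin 2) ℤ_[p]) (g : G)
    (j : Fin 2) :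
    (((glRep ρ).extendScalars ℚ_[p]).extendScalars (Qp2 p)) g (tensorBasis p j) =
      ∑ i, algebraMap ℤ_[p] (Qp2 p) ((ρ g : Matrix (Fin 2) (Fin 2) ℤ_[p]) i j) • tensorBasis p i := by
  have h1 : (ρ g : Matrix (Fin 2) (Fin 2) ℤ_[p]).mulVec (Pi.single j 1) =
      ∑ i, (ρ g : Matrix (Fin 2) (Fin 2) ℤ_[p]) i j • (Pi.single i 1 : Fin 2 → ℤ_[p]) := by
    ext i
    simp [Finset.sum_apply, Pi.single_apply]
  simp only [tensorBasis, Module.Basis.baseChange_apply, Pi.basisFun_apply]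
  change (1 : Qp2 p) ⊗ₜ[ℚ_[p]] ((1 : ℚ_[p]) ⊗ₜ[ℤ_[p]]
    (ρ g : Matrix (Fin 2) (Fin 2) ℤ_[p]).mulVec (Pi.single j 1)) = _
  rw [h1, TensorProduct.tmul_sum, TensorProduct.tmul_sum]
  refine Finset.sum_congr rfl fun i _ => ?_
  rw [TensorProduct.tmul_smul, ← algebraMap_smul ℚ_[p], TensorProduct.tmul_smul,
    ← algebraMap_smul (Qp2 p)]
  rfl

/-- The eigenvectors `√d ⊗ e₁ ± e₂` of `Q_{p²} ⊗ V`. -/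
noncomputable def _root_.eigenvector (δ : Zp2 p) (ε : ℤ_[p]) :
    Qp2 p ⊗[ℚ_[p]] (ℚ_[p] ⊗[ℤ_[p]] (Fin 2 → ℤ_[p])) :=
  (δ : Qp2 p) • tensorBasis p 0 + algebraMap ℤ_[p] (Qp2 p) ε • tensorBasis p 1

omit h in
theorem _root_.eigenvector_identity {k W : Type*} [CommRing k] [AddCommGroup W] [Module k W]
    {δ D s ε : k} (x y : k) (b₀ b₁ : W) (hδ : δ ^ 2 = D) (hs : s * s = 1) (hε : ε * ε = 1) :
    δ • (x • b₀ + y • b₁) + ε • ((s * (D * y)) • b₀ + (s * x) • b₁) =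
      (x + s * ε * (y * δ)) • (δ • b₀ + (s * ε) • b₁) := by
  have h1 : δ • (x • b₀ + y • b₁) + ε • ((s * (D * y)) • b₀ + (s * x) • b₁) =
      (δ * x + ε * (s * (D * y))) • b₀ + (δ * y + ε * (s * x)) • b₁ := by module
  rw [h1, smul_add, smul_smul, smul_smul]
  congr 2
  · rw [← hδ]; ring
  · linear_combination (-(y * δ)) * (hs + s ^ 2 * hε)

omit h in
theorem _root_.galSign_mul_self (τ : Gal2 p) : galSign τ * galSign τ = 1 := by
  rcases galSign_eq_one_or τ with h1 | h1 <;> rw [h1] <;> simp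

/-- For sign 1 each line is preserved, with eigenvalue z for ε = 1 and its conjugate for ε = -1; for
sign -1 the lines are exchanged. -/
theorem toGL_eigenvector {G : Type*} [Group G] (κ : G →* Dihedral p) (g : G) {ε : ℤ_[p]}
    (hε : ε * ε = 1) :
    (((glRep (h.toGL.comp κ)).extendScalars ℚ_[p]).extendScalars (Qp2 p)) g (eigenvector δ ε) =
      (algebraMap ℤ_[p] (Qp2 p) (h.basis.repr ((κ g).left : Zp2 p) 0) +
        algebraMap ℤ_[p] (Qp2 p) (galSign (κ g).right) * algebraMap ℤ_[p] (Qp2 p) ε *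
          (algebraMap ℤ_[p] (Qp2 p) (h.basis.repr ((κ g).left : Zp2 p) 1) * (δ : Qp2 p))) •
        eigenvector δ (galSign (κ g).right * ε) := by
  have hsq : (δ : Qp2 p) ^ 2 = algebraMap ℤ_[p] (Qp2 p) d := congrArg Subtype.val h.sq_eq
  have hs' := congrArg (algebraMap ℤ_[p] (Qp2 p)) (galSign_mul_self (κ g).right)
  have hε' := congrArg (algebraMap ℤ_[p] (Qp2 p)) hε
  rw [map_mul, map_one] at hs' hε'
  have hm : ((h.toGL.comp κ g : GL (Fin 2) ℤ_[p]) : Matrix (Fin 2) (Fin 2) ℤ_[p]) =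
      !![h.basis.repr ((κ g).left : Zp2 p) 0,
          galSign (κ g).right * (d * h.basis.repr ((κ g).left : Zp2 p) 1);
        h.basis.repr ((κ g).left : Zp2 p) 1,
          galSign (κ g).right * h.basis.repr ((κ g).left : Zp2 p) 0] := rfl
  rw [eigenvector, map_add, map_smul, map_smul, extendScalars_tensorBasis,
    extendScalars_tensorBasis, Fin.sum_univ_two, Fin.sum_univ_two, hm, eigenvector, map_mul]
  have hid := eigenvector_identity (algebraMap ℤ_[p] (Qp2 p) (h.basis.repr ((κ g).left : Zp2 p) 0))
    (algebraMap ℤ_[p] (Qp2 p) (h.basis.repr ((κ g).left : Zp2 p) 1)) (tensorBasis p 0)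
    (tensorBasis p 1) hsq hs' hε'
  rw [← hid, ← map_mul, ← map_mul, ← map_mul]
  rfl

omit h in
-- The change of basis has determinant -2 c δ, which is nonzero in characteristic zero, so p = 2
-- needs no special treatment.
theorem _root_.eigenvector_basis_aux {k W : Type*} [Field k] [CharZero k] [AddCommGroup W]
    [Module k W] (B : Module.Basis (Fin 2) k W) {δ c : k} (hδ : δ ≠ 0) (hc : c ≠ 0) :
    (∀ a b : k, a • (δ • B 0 + (1 : k) • B 1) + b • c • (δ • B 0 + (-1 : k) • B 1) = 0 →
        a = 0 ∧ b = 0) ∧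
      ∀ w, ∃ a b : k, w = a • (δ • B 0 + (1 : k) • B 1) + b • c • (δ • B 0 + (-1 : k) • B 1) := by
  have hcomb (a b : k) : a • (δ • B 0 + (1 : k) • B 1) + b • c • (δ • B 0 + (-1 : k) • B 1) =
      ((a + b * c) * δ) • B 0 + (a - b * c) • B 1 := by module
  constructor
  · intro a b hab
    rw [hcomb] at hab
    have h0 := congrArg (fun w => B.repr w 0) hab
    have h1 := congrArg (fun w => B.repr w 1) hab
    simp [hδ] at h0 h1
    have h2 : (2 : k) * a = 0 := by linear_combination h0 + h1
    have ha : a = 0 := (mul_eq_zero.mp h2).resolve_left two_ne_zero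
    rw [ha, zero_add] at h0
    exact ⟨ha, (mul_eq_zero.mp h0).resolve_right hc⟩
  · intro w
    have hw := B.sum_repr w
    rw [Fin.sum_univ_two] at hw
    set u := B.repr w 0
    set v := B.repr w 1
    refine ⟨(u / δ + v) / 2, (u / δ - v) / 2 / c, ?_⟩
    rw [hcomb, ← hw]
    congr 2 <;> field_simp <;> ring

/-- The vectors `√d ⊗ e₁ ± e₂` form a basis. -/
theorem eigenvector_basis {c : Qp2 p} (hc : c ≠ 0) :
    (∀ a b : Qp2 p, a • eigenvector δ 1 + b • c • eigenvector δ (-1) = 0 → a = 0 ∧ b = 0) ∧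
      ∀ w, ∃ a b : Qp2 p, w = a • eigenvector δ 1 + b • c • eigenvector δ (-1) := by
  have hδ : (δ : Qp2 p) ≠ 0 := fun h0 => h.ne_zero (Subtype.ext h0)
  have : CharZero (Qp2 p) := charZero_of_injective_algebraMap (algebraMap ℚ_[p] (Qp2 p)).injective
  have := eigenvector_basis_aux (tensorBasis p) hδ hc
  have h1 : algebraMap ℤ_[p] (Qp2 p) 1 = 1 := map_one _
  have h2 : algebraMap ℤ_[p] (Qp2 p) (-1) = -1 := by rw [map_neg, h1]
  rw [eigenvector, eigenvector, h1, h2]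
  exact this

/-- The base change of `V_r(s)` is induced from the character `η ∘ χ₂`. -/
theorem nonempty_equiv_indRep {e : ℕ → PadicAlgCl p} (he : IsTateGenerator e)
    {χ : GQp2 p →* (Zp2 p)ˣ} {π : GQp p →* Dihedral p} {η : (Zp2 p)ˣ →* (Zp2 p)ˣ}
    (hχ : IsLubinTateCharacter χ) (hπ : IsLubinTateProjection e π)
    (hη : ∀ τ z, η (galAct p τ z) = galAct p τ (η z)) :
    Nonempty (((VRS h hη π).extendScalars (Qp2 p)).Equiv (indRep (η.comp χ))) := by
  obtain ⟨g₀, hg₀⟩ := h.exists_notMem_GQp2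
  have hg₀' : g₀⁻¹ ∉ GQp2 p := fun hm => hg₀ (by simpa using inv_mem hm)
  set κ : GQp p →* Dihedral p := (etaMap hη).comp π
  have hright (g : GQp p) : (κ g).right = resQp2 p g := eq_resQp2 (hπ.right g)
  have hcoord (z : Zp2 p) : algebraMap ℤ_[p] (Qp2 p) (h.basis.repr z 0) +
      algebraMap ℤ_[p] (Qp2 p) (h.basis.repr z 1) * (δ : Qp2 p) = z :=
    (congrArg Subtype.val (h.eq_coord z)).symm
  have hact := h.toGL_eigenvector κ
  have hmem (g : GQp2 p) : (VRS h hη π).extendScalars (Qp2 p) g (eigenvector δ 1) =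
      charRep (η.comp χ) g 1 • eigenvector δ 1 := by
    have hπg := h.projection_left_eq he hπ hχ g
    have hκ : κ g = ⟨η (χ g), 1⟩ := by
      change etaMap hη (π g) = _
      rw [hπg]
      rfl
    have h1 := hact g (ε := 1) (one_mul 1)
    -- With sign 1 and ε = 1 the scalar x + y√d is η(χ₂(g)) itself.
    rw [hκ, galSign_eq_one_iff.mpr rfl, map_one, one_mul, one_mul, one_mul, hcoord] at h1
    refine h1.trans ?_
    congr 1
    exact (mul_one _).symm
  have hs : galSign (resQp2 p g₀⁻¹) = -1 := by
    rw [mem_GQp2_iff, ← galSign_eq_one_iff] at hg₀'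
    exact (galSign_eq_one_or _).resolve_left hg₀'
  obtain ⟨c, hc, hcv⟩ : ∃ c : Qp2 p, c ≠ 0 ∧
      (VRS h hη π).extendScalars (Qp2 p) g₀⁻¹ (eigenvector δ 1) = c • eigenvector δ (-1) := by
    have h1 := hact g₀⁻¹ (ε := 1) (one_mul 1)
    rw [hright, hs, mul_one] at h1
    refine ⟨_, ?_, h1⟩
    -- The scalar c is x - y√d, where x + y√d is the unit component at g₀⁻¹; if c vanished, so would
    -- x and y, hence the unit.
    rw [map_neg, map_one, mul_one, neg_one_mul, ← sub_eq_add_neg]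
    intro h0
    rw [sub_eq_zero] at h0
    have h2 := h.coord_zero (x := h.basis.repr ((κ g₀⁻¹).left : Zp2 p) 0)
      (y := -h.basis.repr ((κ g₀⁻¹).left : Zp2 p) 1) (by
        apply Subtype.val_injective
        rw [map_neg, neg_mul, ← sub_eq_add_neg]
        exact sub_eq_zero.mpr h0)
    have h3 := h.eq_coord ((κ g₀⁻¹).left : Zp2 p)
    rw [h2.1, neg_eq_zero.mp h2.2, map_zero, zero_mul, add_zero] at h3
    exact (κ g₀⁻¹).left.ne_zero h3
  obtain ⟨hli, hspan⟩ := h.eigenvector_basis hc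
  refine nonempty_equiv_ind (charRep (η.comp χ)) _ (v := eigenvector δ 1) hmem (g₀ := g₀)
    (fun g hg => h.mul_inv_mem hg hg₀) ?_ ?_
  · rw [hcv]; exact hli
  · rw [hcv]; exact hspan

end IsSqrtGenerator

end Comparison

theorem mainTheorem4 (p : ℕ) [Fact p.Prime]
    (d : ℤ_[p]) (δ : Zp2 p) (hδ : IsSqrtGenerator p d δ)
    (e : ℕ → PadicAlgCl p) (he : IsTateGenerator e)
    (r : ZMod (p ^ 2 - 1)) (s : ℤ_[p]) :
    -- the objects involved exist and are unique
    (∃! χ₂ : GQp2 p →* (Zp2 p)ˣ, IsLubinTateCharacter χ₂) ∧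
    (∃! π : GQp p →* Dihedral p, IsLubinTateProjection e π) ∧
    (∀ x : (Zp2 p)ˣ, ∃! wy : (Zp2 p)ˣ × (Zp2 p)ˣ, IsOmegaDiam x wy.1 wy.2) ∧
    (∃! η : (Zp2 p)ˣ →* (Zp2 p)ˣ, IsEta r s η) ∧
    -- and the base change of `V_r(s)` is the induced representation
    ∀ (χ₂ : GQp2 p →* (Zp2 p)ˣ) (π : GQp p →* Dihedral p) (η : (Zp2 p)ˣ →* (Zp2 p)ˣ),
      IsLubinTateCharacter χ₂ → IsLubinTateProjection e π → IsEta r s η →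
      ∃ hη : ∀ τ z, η (galAct p τ z) = galAct p τ (η z),
        Nonempty (((VRS hδ hη π).extendScalars (Qp2 p)).Equiv (indRep (η.comp χ₂))) :=
  ⟨hδ.existsUnique_character he, hδ.existsUnique_projection he, hδ.existsUnique_isOmegaDiam,
    hδ.existsUnique_isEta r s, fun _ _ _ hχ hπ hη =>
      ⟨hδ.isEta_galAct hη, hδ.nonempty_equiv_indRep he hχ hπ (hδ.isEta_galAct hη)⟩⟩
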